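/- **Theorem 1.1.** Let $q=3^r$ with $r\ge 1$, let $\mathbb F_q$ be a field of order $q$, put $\varepsilon=q/3$ and $\Omega=\mathbb F_q^3$. Permutations are composed from left to right. Define the following permutations of $\Omega$ (for $u,v,w,e,d\in\mathbb F_q$ and $\lambda,\mu\in\mathbb F_q^*$): $$\alpha_{(u,v,w)}:(a,b,c)\mapsto(a+u,b+v,c+w),\qquad \beta_{\lambda,\mu}:(a,b,c)\mapsto(\lambda a,\mu b,(\lambda\mu)^{2\varepsilon}c),\qquad \gamma_e:(a,b,c)\mapsto(a+eb,b,c),$$ $$\delta:(a,b,c)\mapsto(b,-a,c),\qquad \tau_d:(a,b,c)\mapsto(a+db^2+d^{\varepsilon}c,b,c),\qquad \sigma:(a,b,c)\mapsto(a^3,b^3,c^3),$$ and the groups $A=\langle\alpha_{(u,v,w)}\mid u,v,w\in\mathbb F_q\rangle$, $C=\langle\gamma_e\mid e\in\mathbb F_q\rangle$, $D=\langle\delta\rangle$, $E=\langle\tau_d\mid d\in\mathbb F_q\rangle$, $S=\langle\beta_{\mu^2,\mu}\mid\mu\in\mathbb F_q^*\rangle$, $T=\langle\beta_{\mu,\mu^{-1}}\mid\mu\in\mathbb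 F_q^*\rangle$, $\Sigma=\langle\sigma\rangle$, $M=\langle C,D,T\rangle$, $Q=\langle A,C\rangle$. Let $$G_1=AMS\Sigma=\langle A,M,S,\Sigma\rangle,\qquad G_2=QSET\Sigma=\langle Q,S,E,T,\Sigma\rangle,\qquad G=\langle G_1,G_2\rangle\le \mathrm{Sym}(\Omega).$$ Let $\Delta$ be the coset graph: its vertices are the cosets $G_1g$ and $G_2g$ with $g\in G$, and $G_1g_1$ and $G_2g_2$ are adjacent if and only if $G_1g_1\cap G_2g_2\ne\emptyset$. The group $G$ acts on it by right multiplication. *Terminology.* A $G$-graph is a finite, connected, simple, undirected graph together with a subgroup $G$ of its automorphism group. Let $G_z$ be the stabilizer of the vertex $z$, $\Delta(z)$ the set of neighbours of $z$, $G_z^{\Delta(z)}$ the permutation group induced by $G_z$ on $\Delta(z)$, and $G_z^{[1]}$ the kernel of the action of $G_z$ on $\Delta(z)$. An $s$-arc originating at $x_0$ is a path $(x_0,\dots,x_s)$ with $x_{i-1}\neq x_{i+1}$ for $1\le i\le s-1$. The $G$-graph $\Delta$ is *locally finite* if all $G_z$ are finite, and *locally $s$-arc transitive* if, for every vertex $z$,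 the group $G_z$ is transitive on the $s$-arcs originating at $z$. A locally finite $G$-graph is *of pushing up type* with respect to the 1-arc $(x_1,x_2)$ and the prime $p$ if $C_{G_z}(O_p(G_z^{[1]}))\le O_p(G_z^{[1]})$ for all vertices $z$, and $O_p(G_{x_1}^{[1]})\le O_p(G_{x_2}^{[1]})$. Here $O_p(H)$ is the largest normal $p$-subgroup of $H$. $E_{n}$ denotes an elementary abelian group of order $n$, $\Gamma L_n(q)$ the group of bijective semilinear maps of $\mathbb F_q^n$, $P\Gamma L_n(q)$ its quotient by the nonzero scalars, $A\Gamma L_n(q)=\mathbb F_q^n\rtimes\Gamma L_n(q)$ and $ASL_2(q)=\mathbb F_q^2\rtimes SL_2(q)$ the semidirect products with the natural module, and $\Gamma L_2(q,S_0)=N_{\Gamma L_2(q)}(S_0)$ for a Sylow $3$-subgroup $S_0$ of $SL_2(q)$. In (iii) and (iv), $X\cong N\rtimes H$ means that $X$ is isomorphic to the semidirect product for some action of $H$ on $N$. *Claim.* $\Delta$ is a locally finite and locally $5$-arc transitive $G$-graph. For every edge $\{x_1,x_2\}$ of $\Delta$, with $x_1$ a coset of $G_1$ and $x_2$ a coset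 of $G_2$, $\Delta$ is of pushing up type with respect to $(x_1,x_2)$ and the prime $3$, and the following hold: (i) $|\Delta(x_1)|=q+1$ and $|\Delta(x_2)|=q$; (ii) $G_{x_1}^{\Delta(x_1)}\cong P\Gamma L_2(q)$ and $G_{x_2}^{\Delta(x_2)}\cong A\Gamma L_1(q)$; (iii) $G_{x_1}\cong E_{q^3}\rtimes\Gamma L_2(q)$; (iv) $G_{x_2}\cong(E_q\times U)\rtimes\Gamma L_2(q,S_0)$, where $U$ is a Sylow $3$-subgroup of $ASL_2(q)$ (for all choices of the Sylow subgroups $U$ and $S_0$); (v) $G_{x_2}$ is transitive on the $6$-arcs originating at $x_2$. -/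

import Mathlib

open scoped Pointwise

noncomputable section

namespace CosetGraph

theorem perm_apply_inv {α : Type*} (f : Equiv.Perm α) (x : α) : f (f⁻¹ x) = x :=
  f.apply_symm_apply x

/-! ### Graphs with a group action -/

section GGraph

variable {Γ V : Type*} [Group Γ] [MulAction Γ V]

/-- The action of `Γ` on `V` makes the graph `Δ` into a `Γ`-graph: `Δ` is a finite connected graph
and `Γ` is (via its faithful action on the vertices) a group of automorphisms of `Δ`.
Undirected, loopless and simple are part of `SimpleGraph`. -/
structure IsGGraph (Γ : Type*) {V : Type*} [Group Γ] [MulAction Γ V] (Δ : SimpleGraph V) :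
    Prop where
  finite : Finite V
  connected : Δ.Connected
  adj_smul : ∀ (g : Γ) (x y : V), Δ.Adj (g • x) (g • y) ↔ Δ.Adj x y
  faithful : FaithfulSMul Γ V

/-- All vertex stabilizers are finite. -/
def IsLocallyFinite (Γ V : Type*) [Group Γ] [MulAction Γ V] : Prop :=
  ∀ z : V, Finite (MulAction.stabilizer Γ z)

/-- `(x 0, x 1, …, x s)` is an `s`-arc: consecutive vertices are adjacent and
`x (i - 1) ≠ x (i + 1)` for `1 ≤ i ≤ s - 1`. -/
def IsArc (Δ : SimpleGraph V) (s : ℕ) (x : Fin (s + 1) → V) : Prop :=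
  (∀ i j : Fin (s + 1), (j : ℕ) = i + 1 → Δ.Adj (x i) (x j)) ∧
  (∀ i j : Fin (s + 1), (j : ℕ) = i + 2 → x i ≠ x j)

/-- The stabilizer of `z` is transitive on the `s`-arcs originating at `z`. -/
def ArcTransitiveAt (Γ : Type*) {V : Type*} [Group Γ] [MulAction Γ V] (Δ : SimpleGraph V)
    (s : ℕ) (z : V) : Prop :=
  ∀ x y : Fin (s + 1) → V, IsArc Δ s x → IsArc Δ s y → x 0 = z → y 0 = z →
    ∃ g ∈ MulAction.stabilizer Γ z, ∀ i, g • x i = y i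

/-- Locally `s`-arc transitive. -/
def LocallyArcTransitive (Γ : Type*) {V : Type*} [Group Γ] [MulAction Γ V] (Δ : SimpleGraph V)
    (s : ℕ) : Prop :=
  ∀ z : V, ArcTransitiveAt Γ Δ s z

/-- `Γ_z^{[1]}`: the kernel of the action of the stabilizer `Γ_z` on the neighbours of `z`. -/
def localKernel (Γ : Type*) {V : Type*} [Group Γ] [MulAction Γ V] (Δ : SimpleGraph V) (z : V) :
    Subgroup Γ :=
  MulAction.stabilizer Γ z ⊓ fixingSubgroup Γ (Δ.neighborSet z)

/-- `Γ_z^{Δ(z)}`: the group of permutations of the set `Δ(z)` of neighbours of `z` that is induced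
by the stabilizer `Γ_z`. -/
def localAction (Γ : Type*) {V : Type*} [Group Γ] [MulAction Γ V] (Δ : SimpleGraph V) (z : V) :
    Subgroup (Equiv.Perm (Δ.neighborSet z)) where
  carrier := {π | ∃ g ∈ MulAction.stabilizer Γ z, ∀ w, (π w : V) = g • (w : V)}
  one_mem' := ⟨1, one_mem _, fun w => by simp⟩
  mul_mem' := by
    rintro π ρ ⟨g, hg, hπ⟩ ⟨h, hh, hρ⟩
    exact ⟨g * h, mul_mem hg hh, fun w => by
      rw [Equiv.Perm.mul_apply, hπ, hρ, mul_smul]⟩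
  inv_mem' := by
    rintro π ⟨g, hg, hπ⟩
    refine ⟨g⁻¹, inv_mem hg, fun w => ?_⟩
    rw [eq_inv_smul_iff, ← hπ, perm_apply_inv]

/-- `O_p(H)`, the largest normal `p`-subgroup of the subgroup `H` (as a subgroup of the ambient
group). -/
def pCore {Γ : Type*} [Group Γ] (p : ℕ) (H : Subgroup Γ) : Subgroup Γ :=
  (sSup {P : Subgroup H | P.Normal ∧ IsPGroup p P}).map H.subtype

/-- Local characteristic `p`: `p` is a prime and, for all vertices `z`, the centralizer in `Γ_z` of
`O_p(Γ_z^{[1]})` is contained in `O_p(Γ_z^{[1]})`. -/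
def LocalCharacteristic (Γ : Type*) {V : Type*} [Group Γ] [MulAction Γ V] (Δ : SimpleGraph V)
    (p : ℕ) : Prop :=
  p.Prime ∧ ∀ z : V,
    Subgroup.centralizer (pCore p (localKernel Γ Δ z) : Set Γ) ⊓ MulAction.stabilizer Γ z ≤
      pCore p (localKernel Γ Δ z)

/-- Pushing up type with respect to the 1-arc `(x₁, x₂)` and the prime `p`. -/
def PushingUpType (Γ : Type*) {V : Type*} [Group Γ] [MulAction Γ V] (Δ : SimpleGraph V)
    (p : ℕ) (x₁ x₂ : V) : Prop :=
  IsLocallyFinite Γ V ∧ Δ.Adj x₁ x₂ ∧ LocalCharacteristic Γ Δ p ∧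
    pCore p (localKernel Γ Δ x₁) ≤ pCore p (localKernel Γ Δ x₂)

end GGraph

/-- The (bipartite) coset graph of two subgroups: the vertices are the cosets of `H` and the cosets
of `K`, and a coset of `H` and a coset of `K` are adjacent when they intersect. The group acts on
it by translation. -/
def cosetGraph {Γ : Type*} [Group Γ] (H K : Subgroup Γ) : SimpleGraph ((Γ ⧸ H) ⊕ (Γ ⧸ K)) where
  Adj
    | .inl x, .inr y => ∃ g : Γ, (g : Γ ⧸ H) = x ∧ (g : Γ ⧸ K) = y
    | .inr y, .inl x => ∃ g : Γ, (g : Γ ⧸ H) = x ∧ (g : Γ ⧸ K) = y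
    | _, _ => False
  symm := ⟨by rintro (x | x) (y | y) h <;> exact h⟩
  loopless := ⟨by rintro (x | x) h <;> exact h⟩

/-! ### The standard groups -/

/-- The elementary abelian group of order `p ^ n` (for a prime `p`). -/
abbrev ElementaryAbelian (p n : ℕ) : Type := Multiplicative (Fin n → ZMod p)

/-- `ΓL(V)`: the group of all bijective semilinear maps of the vector space `V` to itself. -/
def GammaL (F V : Type*) [Field F] [AddCommGroup V] [Module F V] : Subgroup (Equiv.Perm V) where
  carrier := {f | (∀ v w, f (v + w) = f v + f w) ∧
    ∃ σ : F ≃+* F, ∀ (c : F) (v : V), f (c • v) = σ c • f v}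
  one_mem' := ⟨fun _ _ => rfl, RingEquiv.refl F, fun _ _ => rfl⟩
  mul_mem' := by
    rintro f g ⟨hf, σ, hσ⟩ ⟨hg, τ, hτ⟩
    refine ⟨fun v w => ?_, τ.trans σ, fun c v => ?_⟩
    · simp only [Equiv.Perm.mul_apply, hg, hf]
    · simp only [Equiv.Perm.mul_apply, hτ, hσ, RingEquiv.trans_apply]
  inv_mem' := by
    rintro f ⟨hf, σ, hσ⟩
    refine ⟨fun v w => ?_, σ.symm, fun c v => ?_⟩
    · rw [Equiv.Perm.inv_eq_iff_eq, hf, perm_apply_inv, perm_apply_inv]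
    · rw [Equiv.Perm.inv_eq_iff_eq, hσ, perm_apply_inv, RingEquiv.apply_symm_apply]

/-- The nonzero scalar multiplications, as a subgroup of `ΓL(V)`. -/
def scalars (F V : Type*) [Field F] [AddCommGroup V] [Module F V] : Subgroup (GammaL F V) where
  carrier := {f | ∃ c : Fˣ, ∀ v, (f : Equiv.Perm V) v = c • v}
  one_mem' := ⟨1, fun v => by simp⟩
  mul_mem' := by
    rintro f g ⟨c, hc⟩ ⟨d, hd⟩
    exact ⟨c * d, fun v => by
      rw [Subgroup.coe_mul, Equiv.Perm.mul_apply, hd, hc, mul_smul]⟩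
  inv_mem' := by
    rintro f ⟨c, hc⟩
    exact ⟨c⁻¹, fun v => by
      rw [Subgroup.coe_inv, Equiv.Perm.inv_eq_iff_eq, hc, smul_inv_smul]⟩

instance scalars_normal (F V : Type*) [Field F] [AddCommGroup V] [Module F V] :
    (scalars F V).Normal where
  conj_mem := by
    rintro f ⟨c, hc⟩ g
    obtain ⟨-, σ, hσ⟩ := g.2
    refine ⟨Units.map σ.toMonoidHom c, fun v => ?_⟩
    simp only [Subgroup.coe_mul, Subgroup.coe_inv, Equiv.Perm.mul_apply, hc, Units.smul_def, hσ,
      perm_apply_inv]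
    rfl

/-- `PΓL(V)`: the group `ΓL(V)` modulo the nonzero scalars. -/
abbrev PGammaL (F V : Type*) [Field F] [AddCommGroup V] [Module F V] : Type _ :=
  GammaL F V ⧸ scalars F V

/-- `AΓL(V) = V ⋊ ΓL(V)`, as the group of all maps `x ↦ h x + b` with `h ∈ ΓL(V)`, `b ∈ V`. -/
def AGammaL (F V : Type*) [Field F] [AddCommGroup V] [Module F V] : Subgroup (Equiv.Perm V) where
  carrier := {f | ∃ h ∈ GammaL F V, ∃ b : V, ∀ x, f x = h x + b}
  one_mem' := ⟨1, one_mem _, 0, fun x => by simp⟩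
  mul_mem' := by
    rintro f g ⟨h, hh, b, hf⟩ ⟨k, hk, c, hg⟩
    exact ⟨h * k, mul_mem hh hk, h c + b, fun x => by
      rw [Equiv.Perm.mul_apply, hg, hf, hh.1, Equiv.Perm.mul_apply, add_assoc]⟩
  inv_mem' := by
    rintro f ⟨h, hh, b, hf⟩
    refine ⟨h⁻¹, inv_mem hh, h⁻¹ (-b), fun x => ?_⟩
    rw [Equiv.Perm.inv_eq_iff_eq, hf, hh.1, perm_apply_inv, perm_apply_inv,
      neg_add_cancel_right]

/-- `SL₂(F)`, as a group of (linear) permutations of the natural module `F²`. -/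
def SL2 (F : Type*) [Field F] : Subgroup (Equiv.Perm (Fin 2 → F)) where
  carrier := {f | ∃ A : Matrix.SpecialLinearGroup (Fin 2) F, ∀ v, f v = A.1.mulVec v}
  one_mem' := ⟨1, fun v => by simp⟩
  mul_mem' := by
    rintro f g ⟨A, hA⟩ ⟨B, hB⟩
    exact ⟨A * B, fun v => by
      rw [Equiv.Perm.mul_apply, hB, hA, Matrix.mulVec_mulVec, Matrix.SpecialLinearGroup.coe_mul]⟩
  inv_mem' := by
    rintro f ⟨A, hA⟩
    refine ⟨A⁻¹, fun v => ?_⟩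
    rw [Equiv.Perm.inv_eq_iff_eq, hA, Matrix.mulVec_mulVec,
      ← Matrix.SpecialLinearGroup.coe_mul, mul_inv_cancel]
    simp

/-- `ASL₂(F) = F² ⋊ SL₂(F)`, as the group of all maps `x ↦ A x + b` with `A ∈ SL₂(F)`, `b ∈ F²`. -/
def ASL2 (F : Type*) [Field F] : Subgroup (Equiv.Perm (Fin 2 → F)) where
  carrier := {f | ∃ A : Matrix.SpecialLinearGroup (Fin 2) F, ∃ b, ∀ v, f v = A.1.mulVec v + b}
  one_mem' := ⟨1, 0, fun v => by simp⟩
  mul_mem' := by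
    rintro f g ⟨A, b, hA⟩ ⟨B, c, hB⟩
    exact ⟨A * B, A.1.mulVec c + b, fun v => by
      rw [Equiv.Perm.mul_apply, hB, hA, Matrix.mulVec_add, Matrix.mulVec_mulVec,
        Matrix.SpecialLinearGroup.coe_mul, add_assoc]⟩
  inv_mem' := by
    rintro f ⟨A, b, hA⟩
    refine ⟨A⁻¹, (A⁻¹).1.mulVec (-b), fun v => ?_⟩
    rw [Equiv.Perm.inv_eq_iff_eq, hA, Matrix.mulVec_add, Matrix.mulVec_mulVec,
      Matrix.mulVec_mulVec, ← Matrix.SpecialLinearGroup.coe_mul, mul_inv_cancel]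
    simp

/-- `ΓL₂(F, S) = N_{ΓL₂(F)}(S)`, for a Sylow 3-subgroup `S` of `SL₂(F)`. -/
def GammaL2N (F : Type*) [Field F] (S : Sylow 3 (SL2 F)) : Subgroup (Equiv.Perm (Fin 2 → F)) :=
  GammaL F (Fin 2 → F) ⊓
    Subgroup.normalizer (((S : Subgroup (SL2 F)).map (SL2 F).subtype : Subgroup _) : Set _)

/-! ### The permutations of `Ω = F³` and the groups they generate

Permutations are composed here from right to left, so that the right cosets `G_i g` of a
left-to-right convention are the left cosets of the same set of permutations. -/

section Construction

variable (F : Type*) [Field F]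

/-- `Ω = {(a, b, c)}`. -/
abbrev Omega : Type _ := F × F × F

variable {F}

/-- `α_{(u,v,w)} : (a, b, c) ↦ (a + u, b + v, c + w)`. -/
def alpha (u v w : F) : Equiv.Perm (Omega F) where
  toFun x := (x.1 + u, x.2.1 + v, x.2.2 + w)
  invFun x := (x.1 - u, x.2.1 - v, x.2.2 - w)
  left_inv x := by simp
  right_inv x := by simp

/-- `β_{λ,μ} : (a, b, c) ↦ (λ a, μ b, (λ μ)^{2 ε} c)`, where `ε = q / 3` and `q = |F|`. -/
def beta (l m : Fˣ) : Equiv.Perm (Omega F) where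
  toFun x := (l * x.1, m * x.2.1, ((l * m) ^ (2 * (Nat.card F / 3)) : Fˣ) * x.2.2)
  invFun x := ((l⁻¹ : Fˣ) * x.1, (m⁻¹ : Fˣ) * x.2.1,
    (((l * m) ^ (2 * (Nat.card F / 3)))⁻¹ : Fˣ) * x.2.2)
  left_inv x := by simp only [Units.inv_mul_cancel_left]
  right_inv x := by simp only [Units.mul_inv_cancel_left]

/-- `γ_e : (a, b, c) ↦ (a + e b, b, c)`. -/
def gamma (e : F) : Equiv.Perm (Omega F) where
  toFun x := (x.1 + e * x.2.1, x.2.1, x.2.2)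
  invFun x := (x.1 - e * x.2.1, x.2.1, x.2.2)
  left_inv x := by simp
  right_inv x := by simp

variable (F) in
/-- `δ : (a, b, c) ↦ (b, -a, c)`. -/
def delta : Equiv.Perm (Omega F) where
  toFun x := (x.2.1, -x.1, x.2.2)
  invFun x := (-x.2.1, x.1, x.2.2)
  left_inv x := by simp
  right_inv x := by simp

/-- `τ_d : (a, b, c) ↦ (a + d b² + d^ε c, b, c)`, where `ε = q / 3` and `q = |F|`. -/
def tau (d : F) : Equiv.Perm (Omega F) where
  toFun x := (x.1 + d * x.2.1 ^ 2 + d ^ (Nat.card F / 3) * x.2.2, x.2.1, x.2.2)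
  invFun x := (x.1 - d ^ (Nat.card F / 3) * x.2.2 - d * x.2.1 ^ 2, x.2.1, x.2.2)
  left_inv x := by simp
  right_inv x := by simp

variable (F)

/-- `σ : (a, b, c) ↦ (a³, b³, c³)`. -/
def sigma [Finite F] [CharP F 3] : Equiv.Perm (Omega F) :=
  haveI : ExpChar F 3 := ExpChar.prime Nat.prime_three
  (frobeniusEquiv F 3).toEquiv.prodCongr
    ((frobeniusEquiv F 3).toEquiv.prodCongr (frobeniusEquiv F 3).toEquiv)

theorem sigma_apply [Finite F] [CharP F 3] (a b c : F) :
    sigma F (a, b, c) = (a ^ 3, b ^ 3, c ^ 3) := rfl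

def groupA : Subgroup (Equiv.Perm (Omega F)) := Subgroup.closure {π | ∃ u v w, π = alpha u v w}

def groupC : Subgroup (Equiv.Perm (Omega F)) := Subgroup.closure {π | ∃ e, π = gamma e}

def groupD : Subgroup (Equiv.Perm (Omega F)) := Subgroup.closure {delta F}

def groupE : Subgroup (Equiv.Perm (Omega F)) := Subgroup.closure {π | ∃ d, π = tau d}

def groupS : Subgroup (Equiv.Perm (Omega F)) := Subgroup.closure {π | ∃ m, π = beta (m ^ 2) m}

def groupT : Subgroup (Equiv.Perm (Omega F)) := Subgroup.closure {π | ∃ m, π = beta m m⁻¹}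

/-- `M = ⟨C, D, T⟩`. -/
def groupM : Subgroup (Equiv.Perm (Omega F)) := groupC F ⊔ groupD F ⊔ groupT F

/-- `Q = ⟨A, C⟩`. -/
def groupQ : Subgroup (Equiv.Perm (Omega F)) := groupA F ⊔ groupC F

variable [Finite F] [CharP F 3]

/-- `Σ = ⟨σ⟩`. -/
def groupSigma : Subgroup (Equiv.Perm (Omega F)) := Subgroup.closure {sigma F}

/-- `G₁ = A M S Σ`. -/
def G1 : Subgroup (Equiv.Perm (Omega F)) := groupA F ⊔ groupM F ⊔ groupS F ⊔ groupSigma F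

/-- `G₂ = Q S E T Σ`. -/
def G2 : Subgroup (Equiv.Perm (Omega F)) :=
  groupQ F ⊔ groupS F ⊔ groupE F ⊔ groupT F ⊔ groupSigma F

/-- `G = ⟨G₁, G₂⟩`. -/
def G : Subgroup (Equiv.Perm (Omega F)) := G1 F ⊔ G2 F

/-- The set of cosets of `G₁` in `G`. -/
abbrev Cosets1 : Type _ := G F ⧸ (G1 F).subgroupOf (G F)

/-- The set of cosets of `G₂` in `G`. -/
abbrev Cosets2 : Type _ := G F ⧸ (G2 F).subgroupOf (G F)

/-- The vertices of `Δ`. -/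
abbrev Vertex : Type _ := Cosets1 F ⊕ Cosets2 F

/-- The coset graph `Δ` on the cosets of `G₁` and `G₂` in `G`. -/
def Delta : SimpleGraph (Vertex F) :=
  cosetGraph ((G1 F).subgroupOf (G F)) ((G2 F).subgroupOf (G F))

end Construction

end CosetGraph

end

open CosetGraph

/-!
`G₁` and `G₂` have explicit normal forms: with `κ` the cube root and `s` a field automorphism, the
elements of `G₁` are the maps `linForm`, which are semilinear on the first two coordinates and twist
the third by `κ(det)²`, and those of `G₂` are the maps `quadForm`
`(a, b, c) ↦ (l sa + d (sb)² + κ(d l²) sc + e sb + u, m sb + v, κ(l m)² sc + w)`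
(`mem_G1_iff`, `mem_G2_iff`). Membership, composition and stabilizers reduce to these parameters.

*Local structure.* The neighbours of `G₁` form a projective line, `G₂` being the point at infinity
and `γ_e δ G₂` the affine points, on which `G₁` acts by its linear part
(`smul_v2_gamma_delta_iff`); the neighbours of `G₂` form an affine line `τ_d G₁` on which `G₂` acts
by `d' = (l s(d) + d₀) / m²`, where `d₀` is the parameter of the element (`smul_v1_tau_iff`).
Hence the local kernels are `A` times scalars, and `Q S`. A `3`-element of the former lies in `A`
because a scalar of `3`-power order is trivial, and `A` is its own centralizer since it is regular
and abelian; this gives the pushing up type (`pushingUpType`).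

*Arcs.* A `6`-arc starting at a coset of `G₂` has a coset of `G₁` in the middle. Two-transitivity on
the projective line standardizes its three middle vertices. The torus then standardizes the two next
ones: it acts on their parameters by `(l / m², m / l²)`, and the exponent matrix has determinant
`-3`, where cubing is bijective (`exists_smul_middle`). The translations `α_{(u,v,0)}` fix these
five vertices and move the two ends independently, since conjugation by `τ_1` turns a translation by
`v` into one with linear part `γ_{-2v} = γ_v` (`exists_smul_ends`). Transitivity on `5`-arcs follows
by extending a `5`-arc at one end.

*Isomorphism types.* The linear part projects `G₁` onto `ΓL₂` with kernel `A`, and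
`(l, m, d) ↦ (l / m, d / m; 0, m)` projects `G₂` onto the upper triangular semilinear group, with
kernel `Q`; both projections split (`exists_linearPart_hom`, `exists_upperPart_hom`). The triangular
group is `ΓL₂(F, S)` because the unitriangular matrices form a Sylow `3`-subgroup of `SL₂`
(`sylowSL2`), whose preimage in `ASL₂` is the second factor of `Q`.
-/

open scoped Pointwise
namespace CosetGraph

/-! ### Homomorphisms and semidirect products from relations -/

section Abstract

variable {H K N : Type*} [Group H] [Group K] [Group N]

/-- A multiplicative functional relation between groups is the graph of a homomorphism. -/
theorem exists_hom_of_rel (R : H → K → Prop) (tot : ∀ h, ∃ k, R h k)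
    (mul : ∀ h h' k k', R h k → R h' k' → R (h * h') (k * k'))
    (uniq : ∀ h k k', R h k → R h k' → k = k') : ∃ f : H →* K, ∀ h, R h (f h) := by
  choose f hf using tot
  exact ⟨MonoidHom.mk' f fun a b => uniq _ _ _ (hf _) (mul _ _ _ _ (hf a) (hf b)), hf⟩

/-- A split extension is a semidirect product. -/
theorem exists_semidirect (i : N →* H) (hi : Function.Injective i) (π : H →* K) (s : K →* H)
    (hs : ∀ k, π (s k) = k) (hker : ∀ h, π h = 1 ↔ ∃ n, i n = h) :
    ∃ φ : K →* MulAut N, Nonempty (H ≃* N ⋊[φ] K) := by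
  let S : GroupExtension N H K :=
    { inl := i
      rightHom := π
      inl_injective := hi
      range_inl_eq_ker_rightHom := by
        ext h
        exact (hker h).symm
      rightHom_surjective := fun k => ⟨s k, hs k⟩ }
  let T : S.Splitting := { s with rightInverse_rightHom := hs }
  exact ⟨_, ⟨T.semidirectProductMulEquiv.symm⟩⟩

theorem nonempty_mulEquiv_of_ker {L : Type*} [Group L] (f : H →* K) (g : H →* L)
    (hf : Function.Surjective f) (hg : Function.Surjective g) (h : ∀ x, f x = 1 ↔ g x = 1) :
    Nonempty (K ≃* L) := by
  have hk : f.ker = g.ker := by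
    ext x
    exact h x
  exact ⟨(QuotientGroup.quotientKerEquivOfSurjective f hf).symm.trans
    ((QuotientGroup.quotientMulEquivOfEq hk).trans
      (QuotientGroup.quotientKerEquivOfSurjective g hg))⟩

/-- In a finite group a nonempty set closed under multiplication is closed under inversion. -/
theorem inv_mem_of_mul_mem [Finite H] (S : Set H) (one : (1 : H) ∈ S)
    (mul : ∀ a b, a ∈ S → b ∈ S → a * b ∈ S) {a : H} (ha : a ∈ S) : a⁻¹ ∈ S := by
  have hpow : ∀ n : ℕ, a ^ n ∈ S := fun n => by
    induction n with
    | zero => simpa using one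
    | succ n ih => rw [pow_succ]; exact mul _ _ ih ha
  have : a⁻¹ = a ^ (orderOf a - 1) := by
    rw [inv_eq_iff_mul_eq_one, ← pow_succ', Nat.sub_add_cancel (orderOf_pos a),
      pow_orderOf_eq_one]
  rw [this]
  exact hpow _

end Abstract

/-! ### The largest normal `p`-subgroup -/

section PCore

variable {Γ : Type*} [Group Γ] {p : ℕ}

theorem le_pCore {P H : Subgroup Γ} (hPH : P ≤ H) (hn : ∀ h ∈ H, ∀ x ∈ P, h * x * h⁻¹ ∈ P)
    (hp : IsPGroup p P) : P ≤ pCore p H := by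
  intro x hx
  refine ⟨⟨x, hPH hx⟩, ?_, rfl⟩
  have hmem : P.subgroupOf H ∈ {P : Subgroup H | P.Normal ∧ IsPGroup p P} := by
    refine ⟨⟨fun n hn' g => ?_⟩, ?_⟩
    · rw [Subgroup.mem_subgroupOf] at hn' ⊢
      exact hn _ g.2 _ hn'
    · exact hp.comap_of_injective H.subtype H.subtype_injective
  exact (le_sSup hmem : P.subgroupOf H ≤ _) (Subgroup.mem_subgroupOf.2 hx)

theorem pCore_le {H Q : Subgroup Γ} (h : ∀ x ∈ H, (∃ k : ℕ, x ^ p ^ k = 1) → x ∈ Q) :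
    pCore p H ≤ Q := by
  rw [pCore, Subgroup.map_le_iff_le_comap]
  refine sSup_le fun P hP x hx => ?_
  obtain ⟨k, hk⟩ := hP.2 ⟨x, hx⟩
  refine h _ x.2 ⟨k, ?_⟩
  simpa using congrArg (fun y : P => ((y : H) : Γ)) hk

end PCore

/-! ### Graphs with a group action -/

section Graph

variable {Γ V : Type*} [Group Γ] [MulAction Γ V] {Δ : SimpleGraph V}

theorem mem_localKernel {z : V} {g : Γ} :
    g ∈ localKernel Γ Δ z ↔ g • z = z ∧ ∀ w, Δ.Adj z w → g • w = w := by
  simp [localKernel, mem_fixingSubgroup_iff]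

theorem mem_localKernel_smul (hΔ : ∀ (g : Γ) (x y : V), Δ.Adj (g • x) (g • y) ↔ Δ.Adj x y)
    {z : V} {g h : Γ} :
    h ∈ localKernel Γ Δ (g • z) ↔ g⁻¹ * h * g ∈ localKernel Γ Δ z := by
  simp only [mem_localKernel, mul_smul, inv_smul_eq_iff]
  refine and_congr_right fun _ => ⟨fun H w hw => H _ ((hΔ _ _ _).2 hw), fun H w hw => ?_⟩
  have := H (g⁻¹ • w) (by rwa [← hΔ g, smul_inv_smul])
  rwa [smul_inv_smul] at this

/-- The local action is the image of the stabilizer, so it is isomorphic to every quotient of the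
stabilizer by the local kernel. -/
theorem nonempty_localAction_mulEquiv
    (hΔ : ∀ (g : Γ) (x y : V), Δ.Adj (g • x) (g • y) ↔ Δ.Adj x y) {K : Type*} [Group K] {z : V}
    (ψ : MulAction.stabilizer Γ z →* K) (hψ : Function.Surjective ψ)
    (hker : ∀ g, ψ g = 1 ↔ (g : Γ) ∈ localKernel Γ Δ z) :
    Nonempty (localAction Γ Δ z ≃* K) := by
  have hadj : ∀ (g : MulAction.stabilizer Γ z) (w : V), Δ.Adj z w → Δ.Adj z ((g : Γ) • w) := by
    intro g w hw
    have h := (hΔ g z w).2 hw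
    rwa [MulAction.mem_stabilizer_iff.1 g.2] at h
  obtain ⟨f, hf⟩ := exists_hom_of_rel
    (fun (g : MulAction.stabilizer Γ z) (π : localAction Γ Δ z) =>
      ∀ w, ((π : Equiv.Perm (Δ.neighborSet z)) w : V) = (g : Γ) • (w : V))
    (fun g => ⟨⟨⟨fun w => ⟨(g : Γ) • (w : V), hadj g w w.2⟩,
        fun w => ⟨((g⁻¹ : MulAction.stabilizer Γ z) : Γ) • (w : V), hadj g⁻¹ w w.2⟩,
        fun w => Subtype.ext (by simp), fun w => Subtype.ext (by simp)⟩,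
        ⟨g, g.2, fun w => rfl⟩⟩, fun w => rfl⟩)
    (fun g g' π π' h h' w => by
      rw [Subgroup.coe_mul, Equiv.Perm.mul_apply, h, h', Subgroup.coe_mul, mul_smul])
    (fun g π π' h h' => Subtype.ext (Equiv.ext fun w => Subtype.ext ((h w).trans (h' w).symm)))
  refine nonempty_mulEquiv_of_ker f ψ ?_ hψ fun g => ?_
  · rintro ⟨π, g, hg, hπ⟩
    refine ⟨⟨g, hg⟩, Subtype.ext (Equiv.ext fun w => Subtype.ext ?_)⟩
    rw [hf, hπ]
  · rw [hker, mem_localKernel]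
    constructor
    · intro h
      refine ⟨g.2, fun w hw => ?_⟩
      have := hf g ⟨w, hw⟩
      rw [h] at this
      exact this.symm
    · rintro ⟨-, h⟩
      refine Subtype.ext (Equiv.ext fun w => Subtype.ext ?_)
      rw [hf, h _ w.2]
      rfl

theorem ncard_neighborSet_smul (hΔ : ∀ (g : Γ) (x y : V), Δ.Adj (g • x) (g • y) ↔ Δ.Adj x y)
    (g : Γ) (z : V) : (Δ.neighborSet (g • z)).ncard = (Δ.neighborSet z).ncard := by
  have : Δ.neighborSet (g • z) = (fun w => g • w) '' Δ.neighborSet z := by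
    ext w
    simp only [SimpleGraph.mem_neighborSet, Set.mem_image]
    constructor
    · intro h
      exact ⟨g⁻¹ • w, by rwa [← hΔ g, smul_inv_smul], smul_inv_smul _ _⟩
    · rintro ⟨v, hv, rfl⟩
      exact (hΔ _ _ _).2 hv
  rw [this, Set.ncard_image_of_injective _ (MulAction.injective g)]

/-- If all `s`-arcs from `z` can be moved to one fixed sequence of vertices, then the stabilizer of
`z` is transitive on them. -/
theorem arcTransitiveAt_of_standard {s : ℕ} {z : V} (std : Fin (s + 1) → V)
    (h : ∀ x, IsArc Δ s x → x 0 = z → ∃ g : Γ, ∀ i, g • x i = std i) :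
    ArcTransitiveAt Γ Δ s z := by
  intro x y hx hy hx0 hy0
  obtain ⟨g, hg⟩ := h x hx hx0
  obtain ⟨k, hk⟩ := h y hy hy0
  have key : ∀ i, (k⁻¹ * g) • x i = y i := fun i => by
    rw [mul_smul, hg, ← hk, inv_smul_smul]
  refine ⟨k⁻¹ * g, ?_, key⟩
  have := key 0
  rwa [hx0, hy0] at this

end Graph

/-! ### Coset graphs -/

section Coset

variable {Γ : Type*} [Group Γ] {H K : Subgroup Γ}

theorem cosetGraph_adj_smul (g : Γ) (x y : (Γ ⧸ H) ⊕ (Γ ⧸ K)) :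
    (cosetGraph H K).Adj (g • x) (g • y) ↔ (cosetGraph H K).Adj x y := by
  have imp : ∀ (g : Γ) (x : Γ ⧸ H) (y : Γ ⧸ K), (cosetGraph H K).Adj (.inl x) (.inr y) →
      (cosetGraph H K).Adj (.inl (g • x)) (.inr (g • y)) := by
    rintro g _ _ ⟨k, rfl, rfl⟩
    exact ⟨g * k, rfl, rfl⟩
  have key : ∀ (x : Γ ⧸ H) (y : Γ ⧸ K), (cosetGraph H K).Adj (.inl (g • x)) (.inr (g • y)) ↔
      (cosetGraph H K).Adj (.inl x) (.inr y) := fun x y => by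
    refine ⟨fun h => ?_, imp g x y⟩
    have := imp g⁻¹ _ _ h
    rwa [inv_smul_smul, inv_smul_smul] at this
  rcases x with x | x <;> rcases y with y | y
  · exact Iff.rfl
  · exact key x y
  · exact key y x
  · exact Iff.rfl

/-- The coset graph is connected as soon as the two subgroups generate the group. -/
theorem cosetGraph_connected (h : H ⊔ K = ⊤) : (cosetGraph H K).Connected := by
  let e : (Γ ⧸ H) ⊕ (Γ ⧸ K) := .inl ((1 : Γ) : Γ ⧸ H)
  have hsmul : ∀ (g : Γ) x y, (cosetGraph H K).Reachable x y →
      (cosetGraph H K).Reachable (g • x) (g • y) := by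
    rintro g x y ⟨w⟩
    induction w with
    | nil => exact SimpleGraph.Reachable.refl _
    | cons hadj _ ih => exact ((cosetGraph_adj_smul g _ _).2 hadj).reachable.trans ih
  let S : Subgroup Γ :=
    { carrier := {g | (cosetGraph H K).Reachable e (g • e)}
      one_mem' := by
        rw [Set.mem_ofPred_eq, one_smul]
      mul_mem' := fun {a b} ha hb => by
        have := hsmul a _ _ hb
        rw [Set.mem_ofPred_eq, mul_smul]
        exact SimpleGraph.Reachable.trans ha this
      inv_mem' := fun {a} ha => by
        have := hsmul a⁻¹ _ _ ha
        rw [inv_smul_smul] at this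
        exact this.symm }
  have hH : H ≤ S := fun a ha => by
    have : a • e = e := by
      change Sum.inl ((a * 1 : Γ) : Γ ⧸ H) = Sum.inl _
      rw [mul_one, QuotientGroup.eq.2]
      simpa using ha
    change (cosetGraph H K).Reachable e (a • e)
    rw [this]
  have hK : K ≤ S := fun a ha => by
    have h1 : (cosetGraph H K).Adj e (.inr ((1 : Γ) : Γ ⧸ K)) := ⟨1, rfl, rfl⟩
    have h2 : (cosetGraph H K).Adj (a • e) (.inr ((1 : Γ) : Γ ⧸ K)) := by
      refine ⟨a, ?_, ?_⟩
      · change _ = ((a * 1 : Γ) : Γ ⧸ H)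
        rw [mul_one]
      · rw [QuotientGroup.eq]
        simpa using ha
    exact h1.reachable.trans h2.symm.reachable
  have hS : ∀ g, g ∈ S := fun g => by
    have : (⊤ : Subgroup Γ) ≤ S := h ▸ sup_le hH hK
    exact this trivial
  have main : ∀ v, (cosetGraph H K).Reachable e v := by
    rintro (x | x) <;> obtain ⟨g, rfl⟩ := QuotientGroup.mk_surjective x
    · have : (cosetGraph H K).Reachable e (g • e) := hS g
      change (cosetGraph H K).Reachable e (.inl ((g * 1 : Γ) : Γ ⧸ H)) at this
      rwa [mul_one] at this
    · have : (cosetGraph H K).Reachable e (g • e) := hS g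
      refine this.trans (SimpleGraph.Adj.reachable ?_)
      refine ⟨g, ?_, rfl⟩
      change _ = ((g * 1 : Γ) : Γ ⧸ H)
      rw [mul_one]
  have : Nonempty ((Γ ⧸ H) ⊕ (Γ ⧸ K)) := ⟨e⟩
  exact ⟨fun u v => (main u).symm.trans (main v)⟩

end Coset

/-! ### Cube roots and field automorphisms in characteristic three -/

section Field

theorem three_eq_zero {F : Type*} [Field F] [CharP F 3] : (3 : F) = 0 := by
  simpa using CharP.cast_eq_zero F 3

variable {F : Type*} [Field F] [Finite F] [CharP F 3]

variable (F) in
/-- The cube root, that is, the inverse of the Frobenius automorphism `x ↦ x ^ 3`. It is the map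
`x ↦ x ^ (q / 3)` of the construction. -/
noncomputable def cubeRoot : F ≃+* F :=
  have : ExpChar F 3 := ExpChar.prime Nat.prime_three
  (frobeniusEquiv F 3).symm

theorem cubeRoot_pow_three (x : F) : cubeRoot F x ^ 3 = x := by
  have : ExpChar F 3 := ExpChar.prime Nat.prime_three
  exact (frobeniusEquiv F 3).apply_symm_apply x

theorem pow_three_injective {x y : F} (h : x ^ 3 = y ^ 3) : x = y := by
  have : ExpChar F 3 := ExpChar.prime Nat.prime_three
  exact (frobeniusEquiv F 3).injective h

theorem cubeRoot_eq_pow (x : F) : x ^ (Nat.card F / 3) = cubeRoot F x := by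
  have := Fintype.ofFinite F
  refine pow_three_injective ?_
  rw [cubeRoot_pow_three, ← pow_mul, Nat.div_mul_cancel]
  · rw [Nat.card_eq_fintype_card, FiniteField.pow_card]
  · rw [← CharP.cast_eq_zero_iff F 3, Nat.card_eq_fintype_card, FiniteField.cast_card_eq_zero]

theorem cubeRoot_comm (s : F ≃+* F) (x : F) : cubeRoot F (s x) = s (cubeRoot F x) := by
  refine pow_three_injective ?_
  rw [cubeRoot_pow_three, ← map_pow, cubeRoot_pow_three]

theorem exists_eq_pow_three_pow (s : F ≃+* F) : ∃ i : ℕ, ∀ x, s x = x ^ 3 ^ i := by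
  have : Fact (Nat.Prime 3) := ⟨Nat.prime_three⟩
  let _ : Algebra (ZMod 3) F := ZMod.algebra F 3
  have hs : ∀ a : ZMod 3, s (algebraMap (ZMod 3) F a) = algebraMap (ZMod 3) F a := fun a =>
    congrFun (congrArg DFunLike.coe (Subsingleton.elim
      ((s : F →+* F).comp (algebraMap (ZMod 3) F)) (algebraMap (ZMod 3) F))) a
  obtain ⟨i, hi⟩ := (FiniteField.bijective_frobeniusAlgEquivOfAlgebraic_pow (ZMod 3) F).2
    (AlgEquiv.ofRingEquiv (f := s) hs)
  refine ⟨i, fun x => ?_⟩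
  have h := congrArg (fun f : Gal(F/ZMod 3) => f x) hi
  simp only [AlgEquiv.coe_pow, FiniteField.coe_frobeniusAlgEquivOfAlgebraic_iterate,
    ZMod.card] at h
  exact h.symm

theorem pow_three_pow_eq_one {x : F} {k : ℕ} (h : x ^ 3 ^ k = 1) : x = 1 := by
  induction k with
  | zero => simpa using h
  | succ k ih =>
    refine ih (pow_three_injective ?_)
    rw [← pow_mul, ← pow_succ, h, one_pow]

end Field

/-! ### Explicit forms of the elements of `G₁` and `G₂` -/

section Forms

theorem det_mul_ne_zero {F : Type*} [Field F] {x y z t x' y' z' t' : F} {s' : F ≃+* F}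
    (h : x * t - y * z ≠ 0) (h' : x' * t' - y' * z' ≠ 0) :
    (x' * s' x + y' * s' z) * (z' * s' y + t' * s' t) -
      (x' * s' y + y' * s' t) * (z' * s' x + t' * s' z) ≠ 0 := by
  have : (x' * s' x + y' * s' z) * (z' * s' y + t' * s' t) -
      (x' * s' y + y' * s' t) * (z' * s' x + t' * s' z) =
      (x' * t' - y' * z') * s' (x * t - y * z) := by
    simp only [map_sub, map_mul]
    ring
  rw [this]
  exact mul_ne_zero h' ((map_ne_zero s').2 h)

variable {F : Type*} [Field F] [Finite F] [CharP F 3]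

/-- The general shape of an element of `G₁`: a semilinear map with matrix `(x, y; z, t)` on the
first two coordinates, the twist of the field automorphism by `det ^ (2/3)` on the third, followed
by a translation. -/
noncomputable def linForm (x y z t u v w : F) (s : F ≃+* F) (p : Omega F) : Omega F :=
  (x * s p.1 + y * s p.2.1 + u, z * s p.1 + t * s p.2.1 + v,
    cubeRoot F (x * t - y * z) ^ 2 * s p.2.2 + w)

/-- The general shape of an element of `G₂`. With `d = 0` it is the shape of an upper triangular
element of `G₁`. -/
noncomputable def quadForm (l m d e u v w : F) (s : F ≃+* F) (p : Omega F) : Omega F :=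
  (l * s p.1 + d * s p.2.1 ^ 2 + cubeRoot F (d * l ^ 2) * s p.2.2 + e * s p.2.1 + u,
    m * s p.2.1 + v, cubeRoot F (l * m) ^ 2 * s p.2.2 + w)

theorem linForm_linForm (x y z t u v w x' y' z' t' u' v' w' : F) (s s' : F ≃+* F) (p : Omega F) :
    linForm x' y' z' t' u' v' w' s' (linForm x y z t u v w s p) =
      linForm (x' * s' x + y' * s' z) (x' * s' y + y' * s' t) (z' * s' x + t' * s' z)
        (z' * s' y + t' * s' t) (x' * s' u + y' * s' v + u') (z' * s' u + t' * s' v + v')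
        (cubeRoot F (x' * t' - y' * z') ^ 2 * s' w + w') (s.trans s') p := by
  simp only [linForm, map_add, map_mul, map_sub, map_pow, cubeRoot_comm, RingEquiv.trans_apply,
    Prod.mk.injEq]
  refine ⟨?_, ?_, ?_⟩ <;> ring

theorem quadForm_quadForm (l m d e u v w l' m' d' e' u' v' w' : F) (s s' : F ≃+* F)
    (p : Omega F) :
    quadForm l' m' d' e' u' v' w' s' (quadForm l m d e u v w s p) =
      quadForm (l' * s' l) (m' * s' m) (l' * s' d + d' * s' m ^ 2)
        (l' * s' e + 2 * d' * s' m * s' v + e' * s' m)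
        (l' * s' u + d' * s' v ^ 2 + cubeRoot F (d' * l' ^ 2) * s' w + e' * s' v + u')
        (m' * s' v + v') (cubeRoot F (l' * m') ^ 2 * s' w + w') (s.trans s') p := by
  simp only [quadForm, map_add, map_mul, map_pow, cubeRoot_comm, RingEquiv.trans_apply,
    Prod.mk.injEq]
  refine ⟨?_, ?_, ?_⟩
  · linear_combination (-(s' (cubeRoot F d) * s' (cubeRoot F l) ^ 2 * s' (s p.2.2))) *
      cubeRoot_pow_three l'
  · ring
  · ring

theorem linForm_upper (x y t u v w : F) (s : F ≃+* F) (p : Omega F) :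
    linForm x y 0 t u v w s p = quadForm x t 0 y u v w s p := by
  simp [linForm, quadForm]

theorem alpha_apply_lin (u v w : F) (p : Omega F) :
    alpha u v w p = linForm 1 0 0 1 u v w (RingEquiv.refl F) p := by
  simp [linForm, alpha]

theorem alpha_apply_quad (u v w : F) (p : Omega F) :
    alpha u v w p = quadForm 1 1 0 0 u v w (RingEquiv.refl F) p := by
  simp [quadForm, alpha]

theorem beta_apply_lin (l m : Fˣ) (p : Omega F) :
    beta l m p = linForm (l : F) 0 0 m 0 0 0 (RingEquiv.refl F) p := by
  simp [linForm, beta, ← cubeRoot_eq_pow, ← pow_mul, mul_comm 2]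

theorem beta_apply_quad (l m : Fˣ) (p : Omega F) :
    beta l m p = quadForm (l : F) m 0 0 0 0 0 (RingEquiv.refl F) p := by
  rw [beta_apply_lin, linForm_upper]

theorem gamma_apply_lin (e : F) (p : Omega F) :
    gamma e p = linForm 1 e 0 1 0 0 0 (RingEquiv.refl F) p := by
  simp [linForm, gamma]

theorem gamma_apply_quad (e : F) (p : Omega F) :
    gamma e p = quadForm 1 1 0 e 0 0 0 (RingEquiv.refl F) p := by
  rw [gamma_apply_lin, linForm_upper]

theorem delta_apply_lin (p : Omega F) :
    delta F p = linForm 0 1 (-1) 0 0 0 0 (RingEquiv.refl F) p := by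
  simp [linForm, delta]

theorem tau_apply_quad (d : F) (p : Omega F) :
    tau d p = quadForm 1 1 d 0 0 0 0 (RingEquiv.refl F) p := by
  simp [quadForm, tau, cubeRoot_eq_pow]

variable (F) in
/-- The cubing automorphism of `F`. -/
noncomputable def frob : F ≃+* F := (cubeRoot F).symm

theorem frob_apply (x : F) : frob F x = x ^ 3 := by
  rw [frob, RingEquiv.symm_apply_eq]
  refine pow_three_injective ?_
  rw [cubeRoot_pow_three]

theorem sigma_apply_lin (p : Omega F) :
    sigma F p = linForm 1 0 0 1 0 0 0 (frob F) p := by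
  obtain ⟨a, b, c⟩ := p
  simp [linForm, sigma_apply, frob_apply]

theorem sigma_apply_quad (p : Omega F) :
    sigma F p = quadForm 1 1 0 0 0 0 0 (frob F) p := by
  rw [sigma_apply_lin, linForm_upper]

theorem sigma_pow_apply (i : ℕ) (p : Omega F) :
    (sigma F ^ i) p = (p.1 ^ 3 ^ i, p.2.1 ^ 3 ^ i, p.2.2 ^ 3 ^ i) := by
  induction i with
  | zero => simp
  | succ i ih =>
    rw [pow_succ', Equiv.Perm.mul_apply, ih, sigma_apply]
    simp only [pow_succ, pow_mul]

theorem alpha_mem_G1 (u v w : F) : alpha u v w ∈ G1 F :=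
  (le_sup_left.trans (le_sup_left.trans le_sup_left) : groupA F ≤ G1 F)
    (Subgroup.subset_closure ⟨u, v, w, rfl⟩)

theorem alpha_mem_G2 (u v w : F) : alpha u v w ∈ G2 F :=
  (le_sup_left.trans (le_sup_left.trans (le_sup_left.trans (le_sup_left.trans le_sup_left))) :
    groupA F ≤ G2 F) (Subgroup.subset_closure ⟨u, v, w, rfl⟩)

theorem groupM_le_G1 : groupM F ≤ G1 F :=
  le_sup_right.trans (le_sup_left.trans le_sup_left)

theorem gamma_mem_G1 (e : F) : gamma e ∈ G1 F :=
  groupM_le_G1 ((le_sup_left.trans le_sup_left : groupC F ≤ groupM F)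
    (Subgroup.subset_closure ⟨e, rfl⟩))

theorem gamma_mem_G2 (e : F) : gamma e ∈ G2 F :=
  (le_sup_right.trans (le_sup_left.trans (le_sup_left.trans (le_sup_left.trans le_sup_left))) :
    groupC F ≤ G2 F) (Subgroup.subset_closure ⟨e, rfl⟩)

theorem delta_mem_G1 : delta F ∈ G1 F :=
  groupM_le_G1 ((le_sup_right.trans le_sup_left : groupD F ≤ groupM F)
    (Subgroup.subset_closure rfl))

theorem tau_mem_G2 (d : F) : tau d ∈ G2 F :=
  (le_sup_right.trans (le_sup_left.trans le_sup_left) : groupE F ≤ G2 F)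
    (Subgroup.subset_closure ⟨d, rfl⟩)

theorem sigma_mem_G1 : sigma F ∈ G1 F :=
  (le_sup_right : groupSigma F ≤ G1 F) (Subgroup.subset_closure rfl)

theorem sigma_mem_G2 : sigma F ∈ G2 F :=
  (le_sup_right : groupSigma F ≤ G2 F) (Subgroup.subset_closure rfl)

/-- The diagonal torus is generated by `S` and `T`, as `3` does not divide `q - 1`. -/
theorem beta_mem_sup (l m : Fˣ) : beta l m ∈ groupS F ⊔ groupT F := by
  have hk : cubeRoot F ((l * m : Fˣ) : F) ≠ 0 := by simp
  have h3 := cubeRoot_pow_three ((l * m : Fˣ) : F)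
  rw [Units.val_mul] at h3
  generalize hkk : cubeRoot F ((l * m : Fˣ) : F) = k at hk
  rw [Units.val_mul] at hkk
  rw [hkk] at h3
  obtain ⟨μ, rfl⟩ : ∃ μ : Fˣ, (μ : F) = k := ⟨Units.mk0 k hk, rfl⟩
  have h3' : μ ^ 3 = l * m := Units.ext (by simpa using h3)
  have hfac : beta l m = beta (μ ^ 2) μ * beta (μ * m⁻¹) (μ * m⁻¹)⁻¹ := by
    have e1 : μ ^ 2 * (μ * m⁻¹) = l := by
      rw [← mul_assoc, ← pow_succ, h3', mul_inv_cancel_right]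
    have e2 : μ * (μ * m⁻¹)⁻¹ = m := by simp
    ext p
    · rw [Equiv.Perm.mul_apply]
      simp only [beta, Equiv.coe_fn_mk]
      rw [← mul_assoc, ← Units.val_mul, e1]
    · rw [Equiv.Perm.mul_apply]
      simp only [beta, Equiv.coe_fn_mk]
      rw [← mul_assoc, ← Units.val_mul, e2]
    · rw [Equiv.Perm.mul_apply]
      simp only [beta, Equiv.coe_fn_mk]
      rw [← mul_assoc, ← Units.val_mul, ← h3', mul_inv_cancel, one_pow, mul_one, ← pow_succ]
  rw [hfac]
  exact mul_mem ((le_sup_left : groupS F ≤ _) (Subgroup.subset_closure ⟨μ, rfl⟩))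
    ((le_sup_right : groupT F ≤ _) (Subgroup.subset_closure ⟨_, rfl⟩))

theorem beta_mem_G1 (l m : Fˣ) : beta l m ∈ G1 F :=
  (sup_le (le_sup_right.trans le_sup_left) (le_sup_right.trans groupM_le_G1) :
    groupS F ⊔ groupT F ≤ G1 F) (beta_mem_sup l m)

theorem beta_mem_G2 (l m : Fˣ) : beta l m ∈ G2 F :=
  (sup_le (le_sup_right.trans (le_sup_left.trans (le_sup_left.trans le_sup_left)))
    (le_sup_right.trans le_sup_left) : groupS F ⊔ groupT F ≤ G2 F) (beta_mem_sup l m)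

theorem exists_sigma_pow (s : F ≃+* F) :
    ∃ i : ℕ, ∀ p : Omega F, (sigma F ^ i) p = (s p.1, s p.2.1, s p.2.2) := by
  obtain ⟨i, hi⟩ := exists_eq_pow_three_pow s
  exact ⟨i, fun p => by rw [sigma_pow_apply, ← hi, ← hi, ← hi]⟩

theorem mem_G1_of_upper {g : Equiv.Perm (Omega F)} {x y t u v w : F} {s : F ≃+* F} (hx : x ≠ 0)
    (ht : t ≠ 0) (hg : ∀ p, g p = linForm x y 0 t u v w s p) : g ∈ G1 F := by
  obtain ⟨i, hi⟩ := exists_sigma_pow s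
  have : g = alpha u v w * gamma (y / t) * beta (Units.mk0 x hx) (Units.mk0 t ht) *
      sigma F ^ i := by
    ext1 p
    simp only [Equiv.Perm.mul_apply, hi, hg, beta_apply_lin, gamma_apply_lin, alpha_apply_lin]
    simp [linForm, div_mul_cancel₀ _ ht, ← mul_assoc]
  rw [this]
  exact mul_mem (mul_mem (mul_mem (alpha_mem_G1 _ _ _) (gamma_mem_G1 _)) (beta_mem_G1 _ _))
    (pow_mem sigma_mem_G1 _)

theorem mem_G1_iff {g : Equiv.Perm (Omega F)} :
    g ∈ G1 F ↔ ∃ x y z t u v w s, x * t - y * z ≠ 0 ∧ ∀ p, g p = linForm x y z t u v w s p := by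
  constructor
  · let S : Set (Equiv.Perm (Omega F)) :=
      {g | ∃ x y z t u v w s, x * t - y * z ≠ 0 ∧ ∀ p, g p = linForm x y z t u v w s p}
    have one : (1 : Equiv.Perm (Omega F)) ∈ S :=
      ⟨1, 0, 0, 1, 0, 0, 0, RingEquiv.refl F, by simp, fun p => by simp [linForm]⟩
    have mul : ∀ a b, a ∈ S → b ∈ S → a * b ∈ S := by
      rintro a b ⟨x', y', z', t', u', v', w', s', h', ha⟩ ⟨x, y, z, t, u, v, w, s, h, hb⟩
      exact ⟨_, _, _, _, _, _, _, _, det_mul_ne_zero h h', fun p =>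
        ((congrArg a (hb p)).trans (ha _)).trans (linForm_linForm ..)⟩
    let P : Subgroup (Equiv.Perm (Omega F)) :=
      { carrier := S
        one_mem' := one
        mul_mem' := fun ha hb => mul _ _ ha hb
        inv_mem' := fun ha => inv_mem_of_mul_mem S one mul ha }
    have hP : G1 F ≤ P := by
      refine sup_le (sup_le (sup_le ?_ (sup_le (sup_le ?_ ?_) ?_)) ?_) ?_ <;>
        refine (Subgroup.closure_le P).2 ?_
      · rintro _ ⟨u, v, w, rfl⟩
        exact ⟨_, _, _, _, _, _, _, _, by simp, alpha_apply_lin u v w⟩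
      · rintro _ ⟨e, rfl⟩
        exact ⟨_, _, _, _, _, _, _, _, by simp, gamma_apply_lin e⟩
      · rintro _ rfl
        exact ⟨_, _, _, _, _, _, _, _, by simp, delta_apply_lin⟩
      · rintro _ ⟨m, rfl⟩
        exact ⟨_, _, _, _, _, _, _, _, by simp, beta_apply_lin _ _⟩
      · rintro _ ⟨m, rfl⟩
        exact ⟨_, _, _, _, _, _, _, _, by simp, beta_apply_lin _ _⟩
      · rintro _ rfl
        exact ⟨_, _, _, _, _, _, _, _, by simp, sigma_apply_lin⟩
    exact fun hg => hP hg
  · rintro ⟨x, y, z, t, u, v, w, s, h, hg⟩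
    by_cases hz : z = 0
    · subst hz
      refine mem_G1_of_upper (fun h0 => h ?_) (fun h0 => h ?_) hg <;> simp [h0]
    -- Row reduction: `γ_{-x/z}` clears the entry `x`, and `δ` swaps the rows.
    · have key : delta F * gamma (-(x / z)) * g ∈ G1 F := by
        refine mem_G1_of_upper (x := z) (y := t) (t := (x * t - y * z) / z) (u := v)
          (v := x / z * v - u) (w := w) (s := s) hz (div_ne_zero h hz) fun p => ?_
        simp only [Equiv.Perm.mul_apply, hg, delta, gamma, linForm, Equiv.coe_fn_mk, zero_mul,
          zero_add, mul_zero, sub_zero, mul_div_cancel₀ _ hz, Prod.mk.injEq]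
        refine ⟨trivial, ?_, trivial⟩
        field_simp
        ring
      have := mul_mem (inv_mem (mul_mem delta_mem_G1 (gamma_mem_G1 (-(x / z))))) key
      rwa [inv_mul_cancel_left] at this

theorem mem_G2_iff {g : Equiv.Perm (Omega F)} :
    g ∈ G2 F ↔ ∃ l m d e u v w s, l ≠ 0 ∧ m ≠ 0 ∧ ∀ p, g p = quadForm l m d e u v w s p := by
  constructor
  · let S : Set (Equiv.Perm (Omega F)) :=
      {g | ∃ l m d e u v w s, l ≠ 0 ∧ m ≠ 0 ∧ ∀ p, g p = quadForm l m d e u v w s p}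
    have one : (1 : Equiv.Perm (Omega F)) ∈ S :=
      ⟨1, 1, 0, 0, 0, 0, 0, RingEquiv.refl F, by simp, by simp, fun p => by simp [quadForm]⟩
    have mul : ∀ a b, a ∈ S → b ∈ S → a * b ∈ S := by
      rintro a b ⟨l', m', d', e', u', v', w', s', hl', hm', ha⟩
        ⟨l, m, d, e, u, v, w, s, hl, hm, hb⟩
      refine ⟨_, _, _, _, _, _, _, _, ?_, ?_, fun p =>
        ((congrArg a (hb p)).trans (ha _)).trans (quadForm_quadForm ..)⟩
      · exact mul_ne_zero hl' (by simpa using hl)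
      · exact mul_ne_zero hm' (by simpa using hm)
    let P : Subgroup (Equiv.Perm (Omega F)) :=
      { carrier := S
        one_mem' := one
        mul_mem' := fun ha hb => mul _ _ ha hb
        inv_mem' := fun ha => inv_mem_of_mul_mem S one mul ha }
    have hP : G2 F ≤ P := by
      refine sup_le (sup_le (sup_le (sup_le (sup_le ?_ ?_) ?_) ?_) ?_) ?_ <;>
        refine (Subgroup.closure_le P).2 ?_
      · rintro _ ⟨u, v, w, rfl⟩
        exact ⟨_, _, _, _, _, _, _, _, by simp, by simp, alpha_apply_quad u v w⟩
      · rintro _ ⟨e, rfl⟩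
        exact ⟨_, _, _, _, _, _, _, _, by simp, by simp, gamma_apply_quad e⟩
      · rintro _ ⟨m, rfl⟩
        exact ⟨_, _, _, _, _, _, _, _, by simp, by simp, beta_apply_quad _ _⟩
      · rintro _ ⟨d, rfl⟩
        exact ⟨_, _, _, _, _, _, _, _, by simp, by simp, tau_apply_quad d⟩
      · rintro _ ⟨m, rfl⟩
        exact ⟨_, _, _, _, _, _, _, _, by simp, by simp, beta_apply_quad _ _⟩
      · rintro _ rfl
        exact ⟨_, _, _, _, _, _, _, _, by simp, by simp, sigma_apply_quad⟩
    exact fun hg => hP hg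
  · rintro ⟨l, m, d, e, u, v, w, s, hl, hm, hg⟩
    obtain ⟨i, hi⟩ := exists_sigma_pow s
    have : g = alpha u v w * gamma (e / m) * tau (d / m ^ 2) *
        beta (Units.mk0 l hl) (Units.mk0 m hm) * sigma F ^ i := by
      ext1 p
      have hk : cubeRoot F m ≠ 0 := by simpa using hm
      simp only [Equiv.Perm.mul_apply, hi, hg, beta_apply_quad, gamma_apply_quad,
        alpha_apply_quad, tau_apply_quad, quadForm_quadForm]
      simp only [quadForm, Units.val_mk0, RingEquiv.refl_apply, RingEquiv.trans_apply,
        Prod.mk.injEq, map_mul, map_pow, map_div₀, map_one, map_zero, map_add]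
      refine ⟨?_, ?_, ?_⟩ <;> field_simp <;> ring
    rw [this]
    exact mul_mem (mul_mem (mul_mem (mul_mem (alpha_mem_G2 _ _ _) (gamma_mem_G2 _))
      (tau_mem_G2 _)) (beta_mem_G2 _ _)) (pow_mem sigma_mem_G2 _)

end Forms

/-! ### Vertices and neighbours in the coset graph -/

section Vertices

theorem gamma_inv {F : Type*} [Field F] (e : F) : (gamma e)⁻¹ = gamma (-e) := by
  rw [inv_eq_iff_mul_eq_one]
  ext1 p
  simp [gamma]

theorem delta_inv_apply {F : Type*} [Field F] (p : Omega F) :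
    (delta F)⁻¹ p = (-p.2.1, p.1, p.2.2) := rfl

variable {F : Type*} [Field F] [Finite F] [CharP F 3]

theorem mem_G1_of_quadForm {g : Equiv.Perm (Omega F)} {l m e u v w : F} {s : F ≃+* F} (hl : l ≠ 0)
    (hm : m ≠ 0) (hg : ∀ p, g p = quadForm l m 0 e u v w s p) : g ∈ G1 F :=
  mem_G1_of_upper hl hm fun p => (hg p).trans (linForm_upper ..).symm

theorem mem_G2_iff_of_linForm {g : Equiv.Perm (Omega F)} {x y z t u v w : F} {s : F ≃+* F}
    (h : x * t - y * z ≠ 0) (hg : ∀ p, g p = linForm x y z t u v w s p) : g ∈ G2 F ↔ z = 0 := by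
  constructor
  · intro h2
    obtain ⟨l, m, d, e, u', v', w', s', -, -, h'⟩ := mem_G2_iff.1 h2
    have h0 := (hg (0, 0, 0)).symm.trans (h' (0, 0, 0))
    have h1 := (hg (1, 0, 0)).symm.trans (h' (1, 0, 0))
    simp only [linForm, quadForm, map_zero, map_one, mul_zero, mul_one, Prod.mk.injEq] at h0 h1
    linear_combination h1.2.1 - h0.2.1
  · rintro rfl
    refine mem_G2_iff.2 ⟨x, t, 0, y, u, v, w, s, fun h0 => h ?_, fun h0 => h ?_, fun p => ?_⟩
    · simp [h0]
    · simp [h0]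
    · rw [hg, linForm_upper]

theorem mem_G1_iff_of_quadForm {g : Equiv.Perm (Omega F)} {l m d e u v w : F} {s : F ≃+* F}
    (hl : l ≠ 0) (hm : m ≠ 0) (hg : ∀ p, g p = quadForm l m d e u v w s p) :
    g ∈ G1 F ↔ d = 0 := by
  constructor
  · intro h1
    obtain ⟨x, y, z, t, u', v', w', s', -, h'⟩ := mem_G1_iff.1 h1
    have h0 := (hg (0, 0, 0)).symm.trans (h' (0, 0, 0))
    have h1 := (hg (0, 1, 0)).symm.trans (h' (0, 1, 0))
    have h2 := (hg (0, -1, 0)).symm.trans (h' (0, -1, 0))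
    simp only [linForm, quadForm, map_zero, map_one, map_neg, mul_zero, mul_one,
      Prod.mk.injEq] at h0 h1 h2
    linear_combination d * three_eq_zero (F := F) - h1.1 - h2.1 + 2 * h0.1
  · rintro rfl
    exact mem_G1_of_quadForm hl hm hg

theorem G1_le_G : G1 F ≤ G F := le_sup_left

theorem G2_le_G : G2 F ≤ G F := le_sup_right

/-- The vertex `g G₁`. -/
def v1 (g : G F) : Vertex F := .inl g

/-- The vertex `g G₂`. -/
def v2 (g : G F) : Vertex F := .inr g

theorem smul_v1 (g h : G F) : g • v1 h = v1 (g * h) := rfl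

theorem smul_v2 (g h : G F) : g • v2 h = v2 (g * h) := rfl

theorem v1_eq_iff {g h : G F} : v1 g = v1 h ↔ ((h⁻¹ * g : G F) : Equiv.Perm (Omega F)) ∈ G1 F := by
  rw [v1, v1, Sum.inl.injEq, eq_comm, QuotientGroup.eq, Subgroup.mem_subgroupOf]

theorem v2_eq_iff {g h : G F} : v2 g = v2 h ↔ ((h⁻¹ * g : G F) : Equiv.Perm (Omega F)) ∈ G2 F := by
  rw [v2, v2, Sum.inr.injEq, eq_comm, QuotientGroup.eq, Subgroup.mem_subgroupOf]

theorem smul_v1_one_iff {g : G F} : g • v1 (1 : G F) = v1 1 ↔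
    (g : Equiv.Perm (Omega F)) ∈ G1 F := by
  rw [smul_v1, v1_eq_iff, inv_one, one_mul, mul_one]

theorem smul_v2_one_iff {g : G F} : g • v2 (1 : G F) = v2 1 ↔
    (g : Equiv.Perm (Omega F)) ∈ G2 F := by
  rw [smul_v2, v2_eq_iff, inv_one, one_mul, mul_one]

theorem adj_smul (g : G F) (x y : Vertex F) :
    (Delta F).Adj (g • x) (g • y) ↔ (Delta F).Adj x y :=
  cosetGraph_adj_smul g x y

theorem exists_smul_of_adj {x y : Vertex F} (hx : x ∈ Set.range Sum.inl) (h : (Delta F).Adj x y) :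
    ∃ g : G F, x = g • v1 1 ∧ y = g • v2 1 := by
  obtain ⟨x, rfl⟩ := hx
  rcases y with y | y
  · exact h.elim
  · obtain ⟨g, rfl, rfl⟩ := h
    refine ⟨g, ?_, ?_⟩
    · rw [smul_v1, mul_one, v1]
    · rw [smul_v2, mul_one, v2]

theorem mem_range_inl_of_adj {x y : Vertex F} (hx : x ∈ Set.range Sum.inr)
    (h : (Delta F).Adj x y) : y ∈ Set.range Sum.inl := by
  obtain ⟨x, rfl⟩ := hx
  rcases y with y | y
  · exact ⟨y, rfl⟩
  · exact h.elim

theorem mem_range_inr_of_adj {x y : Vertex F} (hx : x ∈ Set.range Sum.inl)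
    (h : (Delta F).Adj x y) : y ∈ Set.range Sum.inr := by
  obtain ⟨x, rfl⟩ := hx
  rcases y with y | y
  · exact h.elim
  · exact ⟨y, rfl⟩

theorem exists_eq_smul_v1 (x : Cosets1 F) : ∃ g : G F, (.inl x : Vertex F) = g • v1 1 := by
  obtain ⟨g, rfl⟩ := QuotientGroup.mk_surjective x
  exact ⟨g, by rw [smul_v1, mul_one, v1]⟩

theorem exists_eq_smul_v2 (x : Cosets2 F) : ∃ g : G F, (.inr x : Vertex F) = g • v2 1 := by
  obtain ⟨g, rfl⟩ := QuotientGroup.mk_surjective x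
  exact ⟨g, by rw [smul_v2, mul_one, v2]⟩

/-- `α_{(u,v,w)}` as an element of `G`. -/
def gAlpha (u v w : F) : G F := ⟨alpha u v w, G1_le_G (alpha_mem_G1 u v w)⟩

/-- `β_{l,m}` as an element of `G`. -/
noncomputable def gBeta (l m : Fˣ) : G F := ⟨beta l m, G1_le_G (beta_mem_G1 l m)⟩

/-- `γ_e` as an element of `G`. -/
def gGamma (e : F) : G F := ⟨gamma e, G1_le_G (gamma_mem_G1 e)⟩

variable (F) in
/-- `δ` as an element of `G`. -/
def gDelta : G F := ⟨delta F, G1_le_G delta_mem_G1⟩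

/-- `τ_d` as an element of `G`. -/
noncomputable def gTau (d : F) : G F := ⟨tau d, G2_le_G (tau_mem_G2 d)⟩

theorem tau_inv (d : F) : (tau d)⁻¹ = tau (-d) := by
  rw [inv_eq_iff_mul_eq_one]
  ext1 p
  simp only [Equiv.Perm.mul_apply, tau_apply_quad, quadForm_quadForm]
  simp [quadForm]

/-- The vertices `γ_e δ G₂` are the affine points, with coordinate `e`, of the projective line
formed by the neighbours of `G₁`; `G₁` acts on them by semilinear fractional transformations. -/
theorem smul_v2_gamma_delta_iff {g : G F} {x y z t u v w : F} {s : F ≃+* F}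
    (h : x * t - y * z ≠ 0) (hg : ∀ p, (g : Equiv.Perm (Omega F)) p = linForm x y z t u v w s p)
    (e e' : F) : g • v2 (gGamma e * gDelta F) = v2 (gGamma e' * gDelta F) ↔
      x * s e + y = e' * (z * s e + t) := by
  have hdet : (z * s e + t) * (x - e' * z) - -z * (e' * (z * s e + t) - (x * s e + y)) =
      x * t - y * z := by ring
  rw [smul_v2, v2_eq_iff, mem_G2_iff_of_linForm (x := z * s e + t) (y := -z)
    (z := e' * (z * s e + t) - (x * s e + y)) (t := x - e' * z) (u := -v) (v := u - e' * v) (w := w)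
    (s := s) (by rwa [hdet]), sub_eq_zero, eq_comm]
  intro p
  have : (((gGamma e' * gDelta F)⁻¹ * (g * (gGamma e * gDelta F)) : G F) : Equiv.Perm (Omega F)) p =
      (delta F)⁻¹ (gamma (-e') ((g : Equiv.Perm (Omega F)) (gamma e (delta F p)))) := by
    rw [← gamma_inv, mul_inv_rev]
    rfl
  rw [this, hg, delta_inv_apply]
  simp only [linForm, hdet, gamma, delta, Equiv.coe_fn_mk, map_add, map_mul, map_neg,
    Prod.mk.injEq, and_true]
  constructor <;> ring

/-- The neighbours of `G₂` are the vertices `τ_d G₁`, and `G₂` acts on the parameter `d` by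
semilinear affine transformations. -/
theorem smul_v1_tau_iff {g : G F} {l m d₀ e u v w : F} {s : F ≃+* F} (hl : l ≠ 0) (hm : m ≠ 0)
    (hg : ∀ p, (g : Equiv.Perm (Omega F)) p = quadForm l m d₀ e u v w s p) (d d' : F) :
    g • v1 (gTau d) = v1 (gTau d') ↔ l * s d + d₀ = d' * m ^ 2 := by
  have : ∀ p, (((gTau d')⁻¹ * (g * gTau d) : G F) : Equiv.Perm (Omega F)) p =
      tau (-d') ((g : Equiv.Perm (Omega F)) (tau d p)) := by
    intro p
    rw [← tau_inv]
    rfl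
  have hk := fun p => (((this p).trans (congrArg (tau (-d')) ((congrArg (g : Equiv.Perm (Omega F))
    (tau_apply_quad d p)).trans ((hg _).trans (quadForm_quadForm ..))))).trans
      (tau_apply_quad _ _)).trans (quadForm_quadForm ..)
  rw [smul_v1, v1_eq_iff, mem_G1_iff_of_quadForm (by simpa using hl) (by simpa using hm) hk]
  simp only [RingEquiv.refl_apply, map_one, one_pow, mul_one, one_mul]
  rw [neg_mul, ← sub_eq_add_neg, sub_eq_zero]

theorem smul_v2_one_iff_of_linForm {g : G F} {x y z t u v w : F} {s : F ≃+* F}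
    (h : x * t - y * z ≠ 0) (hg : ∀ p, (g : Equiv.Perm (Omega F)) p = linForm x y z t u v w s p) :
    g • v2 (1 : G F) = v2 1 ↔ z = 0 := by
  rw [smul_v2_one_iff, mem_G2_iff_of_linForm h hg]

theorem adj_v1_one_iff {y : Vertex F} :
    (Delta F).Adj (v1 1) y ↔ y = v2 1 ∨ ∃ e, y = v2 (gGamma e * gDelta F) := by
  have hadj : ∀ g : G F, (g : Equiv.Perm (Omega F)) ∈ G1 F → (Delta F).Adj (v1 1) (v2 g) :=
    fun g hg => ⟨g, by
      have := smul_v1_one_iff.2 hg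
      rw [smul_v1, mul_one] at this
      exact Sum.inl_injective this, rfl⟩
  constructor
  · intro h
    obtain ⟨g, h1, rfl⟩ := exists_smul_of_adj ⟨_, rfl⟩ h
    obtain ⟨x, y, z, t, u, v, w, s, hdet, hg⟩ := mem_G1_iff.1 (smul_v1_one_iff.1 h1.symm)
    by_cases hz : z = 0
    · exact Or.inl ((smul_v2_one_iff_of_linForm hdet hg).2 hz)
    · refine Or.inr ⟨x / z, ?_⟩
      -- The point `G₂` at infinity is the image under `δ` of the affine point `0`.
      have hd : v2 (1 : G F) = gDelta F • v2 (gGamma 0 * gDelta F) := by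
        rw [smul_v2, eq_comm, ← mul_one (gDelta F * _), ← smul_v2,
          smul_v2_one_iff_of_linForm (x := -1) (y := 0) (z := 0) (t := -1) (u := 0) (v := 0)
            (w := 0) (s := RingEquiv.refl F) (by simp)]
        intro p
        change delta F (gamma 0 (delta F p)) = _
        simp [delta, gamma, linForm]
      rw [hd, smul_smul, smul_v2_gamma_delta_iff (x := -y) (y := x) (z := -t) (t := z) (u := u)
        (v := v) (w := w) (s := s) (fun h0 => hdet (by linear_combination h0))]
      · simp [div_mul_cancel₀ _ hz]
      · intro p
        change (g : Equiv.Perm (Omega F)) (delta F p) = _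
        have : -y * z - x * -t = x * t - y * z := by ring
        rw [hg]
        simp only [linForm, delta, Equiv.coe_fn_mk, map_neg, this, Prod.mk.injEq, and_true]
        constructor <;> ring
  · rintro (rfl | ⟨e, rfl⟩)
    · exact hadj 1 (one_mem _)
    · exact hadj _ (mul_mem (gamma_mem_G1 e) delta_mem_G1)

theorem v1_one_eq : v1 (1 : G F) = v1 (gTau 0) := by
  rw [v1_eq_iff, mem_G1_iff_of_quadForm one_ne_zero one_ne_zero (d := 0)]
  intro p
  change (tau 0)⁻¹ p = _
  rw [tau_inv, neg_zero, tau_apply_quad]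

theorem adj_v2_one_iff {y : Vertex F} : (Delta F).Adj (v2 1) y ↔ ∃ d, y = v1 (gTau d) := by
  constructor
  · intro h
    obtain ⟨g, rfl, h2⟩ := exists_smul_of_adj (mem_range_inl_of_adj ⟨_, rfl⟩ h) h.symm
    obtain ⟨l, m, d, e, u, v, w, s, hl, hm, hg⟩ := mem_G2_iff.1 (smul_v2_one_iff.1 h2.symm)
    refine ⟨d / m ^ 2, ?_⟩
    rw [v1_one_eq, smul_v1_tau_iff hl hm hg]
    field_simp
    simp
  · rintro ⟨d, rfl⟩
    refine SimpleGraph.Adj.symm ⟨gTau d, rfl, ?_⟩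
    have := (smul_v2_one_iff (g := gTau d)).2 (tau_mem_G2 d)
    rw [smul_v2, mul_one] at this
    exact Sum.inr_injective this

theorem v1_gTau_injective : Function.Injective fun d : F => v1 (gTau d) := by
  intro d d' h
  have h1 : (1 : G F) • v1 (gTau d) = v1 (gTau d') := by rwa [one_smul]
  rw [smul_v1_tau_iff one_ne_zero one_ne_zero (d₀ := 0) (e := 0) (u := 0) (v := 0) (w := 0)
    (s := RingEquiv.refl F) (fun p => by simp [quadForm])] at h1
  simpa using h1

theorem v2_gGamma_gDelta_injective :
    Function.Injective fun e : F => v2 (gGamma e * gDelta F) := by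
  intro e e' h
  have h1 : (1 : G F) • v2 (gGamma e * gDelta F) = v2 (gGamma e' * gDelta F) := by rwa [one_smul]
  rw [smul_v2_gamma_delta_iff (x := 1) (y := 0) (z := 0) (t := 1) (u := 0) (v := 0) (w := 0)
    (s := RingEquiv.refl F) (by simp) (fun p => by simp [linForm])] at h1
  simpa using h1

theorem v2_gGamma_gDelta_ne (e : F) : v2 (gGamma e * gDelta F) ≠ v2 1 := by
  rw [← mul_one (gGamma e * gDelta F), ← smul_v2, Ne, smul_v2_one_iff_of_linForm (x := -e) (y := 1)
    (z := -1) (t := 0) (u := 0) (v := 0) (w := 0) (s := RingEquiv.refl F) (by simp)]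
  · simp
  · intro p
    change gamma e (delta F p) = _
    simp only [gamma, delta, linForm, Equiv.coe_fn_mk, RingEquiv.refl_apply]
    simp
    ring

theorem ncard_neighborSet_v1 :
    ((Delta F).neighborSet (v1 1)).ncard = Nat.card F + 1 := by
  have : (Delta F).neighborSet (v1 1) =
      insert (v2 1) (Set.range fun e : F => v2 (gGamma e * gDelta F)) := by
    ext y
    simp only [SimpleGraph.mem_neighborSet, adj_v1_one_iff, Set.mem_insert_iff, Set.mem_range,
      eq_comm]
  rw [this, Set.ncard_insert_of_notMem]
  · rw [← Set.image_univ, Set.ncard_image_of_injective _ v2_gGamma_gDelta_injective,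
      Set.ncard_univ]
  · rintro ⟨e, he⟩
    exact v2_gGamma_gDelta_ne e he

theorem ncard_neighborSet_v2 : ((Delta F).neighborSet (v2 1)).ncard = Nat.card F := by
  have : (Delta F).neighborSet (v2 1) = Set.range fun d : F => v1 (gTau d) := by
    ext y
    simp only [SimpleGraph.mem_neighborSet, adj_v2_one_iff, Set.mem_range, eq_comm]
  rw [this, ← Set.image_univ, Set.ncard_image_of_injective _ v1_gTau_injective, Set.ncard_univ]

end Vertices

/-! ### Transitivity on arcs -/

section Arcs

variable {Γ V : Type*} [Group Γ] [MulAction Γ V] {Δ : SimpleGraph V}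

theorem IsArc.smul (hΔ : ∀ (g : Γ) (x y : V), Δ.Adj (g • x) (g • y) ↔ Δ.Adj x y) {s : ℕ}
    {x : Fin (s + 1) → V} (hx : IsArc Δ s x) (g : Γ) : IsArc Δ s fun i => g • x i :=
  ⟨fun i j h => (hΔ _ _ _).2 (hx.1 i j h), fun i j h e => hx.2 i j h (MulAction.injective g e)⟩

theorem IsArc.snoc {Δ : SimpleGraph V} {s : ℕ} {x : Fin (s + 2) → V} (hx : IsArc Δ (s + 1) x)
    {v : V} (h : Δ.Adj (x (Fin.last _)) v) (hne : x (Fin.last s).castSucc ≠ v) :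
    IsArc Δ (s + 2) (Fin.snoc x v : Fin (s + 3) → V) := by
  constructor
  · intro i j hij
    induction j using Fin.lastCases with
    | last =>
      induction i using Fin.lastCases with
      | last => simp at hij
      | cast i =>
        have : i = Fin.last _ := Fin.ext (by simpa using hij.symm)
        subst this
        simpa using h
    | cast j =>
      induction i using Fin.lastCases with
      | last => simp at hij; omega
      | cast i => simpa using hx.1 i j (by simpa using hij)
  · intro i j hij
    induction j using Fin.lastCases with
    | last =>
      induction i using Fin.lastCases with
      | last => simp at hij
      | cast i =>
        have : i = (Fin.last s).castSucc := Fin.ext (by simpa using hij.symm)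
        subst this
        simpa using hne
    | cast j =>
      induction i using Fin.lastCases with
      | last => simp at hij; omega
      | cast i => simpa using hx.2 i j (by simpa using hij)

theorem IsArc.cons {Δ : SimpleGraph V} {s : ℕ} {x : Fin (s + 2) → V} (hx : IsArc Δ (s + 1) x)
    {v : V} (h : Δ.Adj v (x 0)) (hne : v ≠ x 1) :
    IsArc Δ (s + 2) (Fin.cons v x : Fin (s + 3) → V) := by
  constructor
  · intro i j hij
    induction j using Fin.cases with
    | zero => simp at hij
    | succ j =>
      induction i using Fin.cases with
      | zero =>
        have : j = 0 := Fin.ext (by simpa using hij)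
        subst this
        simpa using h
      | succ i => simpa using hx.1 i j (by simpa using hij)
  · intro i j hij
    induction j using Fin.cases with
    | zero => simp at hij
    | succ j =>
      induction i using Fin.cases with
      | zero =>
        have : j = 1 := Fin.ext (by simpa using hij)
        subst this
        exact hne
      | succ i => simpa using hx.2 i j (by simp at hij; omega)

end Arcs

section ArcsDelta

variable {F : Type*} [Field F] [Finite F] [CharP F 3]

variable (F) in
/-- The standard `6`-arc, with `G₁` in the middle and the edge `{G₁, G₂}` next to it. -/
noncomputable def stdArc : Fin 7 → Vertex F :=
  ![gTau (1 : F) • v2 (gGamma 0 * gDelta F), v1 (gTau 1), v2 1, v1 1,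
    v2 (gGamma 0 * gDelta F), gDelta F • v1 (gTau 1),
    gDelta F • gTau (1 : F) • v2 (gGamma 0 * gDelta F)]

theorem smul_smul_of_mul_eq {g h k : G F} (e : g * h = h * k) (y : Vertex F) :
    g • h • y = h • k • y := by
  rw [smul_smul, e, mul_smul]

theorem smul_v1_one_of_lin {g : G F} {x y z t u v w : F} {s : F ≃+* F} (h : x * t - y * z ≠ 0)
    (hg : ∀ p, (g : Equiv.Perm (Omega F)) p = linForm x y z t u v w s p) :
    g • v1 (1 : G F) = v1 1 :=
  smul_v1_one_iff.2 (mem_G1_iff.2 ⟨x, y, z, t, u, v, w, s, h, hg⟩)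

theorem v2_gGamma_zero : v2 (gGamma 0 * gDelta F) = gDelta F • v2 1 := by
  have : (gGamma 0 : G F) = 1 := Subtype.ext (by ext1 p; simp [gGamma, gamma])
  rw [this, one_mul, smul_v2, mul_one]

theorem gTau_smul_v1 (d : F) : gTau d • v1 (1 : G F) = v1 (gTau d) := by
  rw [smul_v1, mul_one]

theorem gDelta_smul_v1 : gDelta F • v1 (1 : G F) = v1 1 :=
  smul_v1_one_iff.2 delta_mem_G1

theorem gTau_smul_v2 (d : F) : gTau d • v2 (1 : G F) = v2 1 :=
  smul_v2_one_iff.2 (tau_mem_G2 d)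

/-- The translation `α_{(u,v,0)}` fixes the five inner vertices of the standard `6`-arc, and it
moves the two ends independently: this is where `τ_1` not being affine comes in. -/
theorem exists_smul_ends (x : Fin 7 → Vertex F) (hx : IsArc (Delta F) 6 x)
    (h1 : x 1 = stdArc F 1) (h2 : x 2 = stdArc F 2) (h3 : x 3 = stdArc F 3)
    (h4 : x 4 = stdArc F 4) (h5 : x 5 = stdArc F 5) : ∃ g : G F, ∀ i, g • x i = stdArc F i := by
  change x 1 = v1 (gTau 1) at h1
  change x 2 = v2 1 at h2
  change x 3 = v1 1 at h3
  change x 4 = v2 (gGamma 0 * gDelta F) at h4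
  change x 5 = gDelta F • v1 (gTau 1) at h5
  obtain ⟨e, h0⟩ : ∃ e, x 0 = gTau (1 : F) • v2 (gGamma e * gDelta F) := by
    have hadj := (hx.1 0 1 rfl).symm
    have hne := hx.2 0 2 rfl
    rw [h1, ← gTau_smul_v1, ← smul_inv_smul (gTau (1 : F)) (x 0), adj_smul, adj_v1_one_iff] at hadj
    obtain h | ⟨e, h⟩ := hadj
    · rw [inv_smul_eq_iff, gTau_smul_v2] at h
      exact absurd (h.trans h2.symm) hne
    · exact ⟨e, inv_smul_eq_iff.1 h⟩
  obtain ⟨e', h6⟩ : ∃ e, x 6 = gDelta F • gTau (1 : F) • v2 (gGamma e * gDelta F) := by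
    have hadj := hx.1 5 6 rfl
    have hne := hx.2 4 6 rfl
    rw [h5, ← gTau_smul_v1, ← smul_inv_smul (gDelta F) (x 6), adj_smul,
      ← smul_inv_smul (gTau (1 : F)) (_ • x 6), adj_smul, adj_v1_one_iff] at hadj
    obtain h | ⟨e, h⟩ := hadj
    · rw [inv_smul_eq_iff, gTau_smul_v2, inv_smul_eq_iff, ← v2_gGamma_zero] at h
      exact absurd (h4.trans h.symm) hne
    · exact ⟨e, inv_smul_eq_iff.1 (inv_smul_eq_iff.1 h)⟩
  -- Conjugation by `τ_1` turns `α_{(u,v,0)}` into an element with linear part `γ_{-2v} = γ_v`.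
  have conj : ∀ u v : F, ∃ k : G F, gAlpha u v 0 * gTau 1 = gTau 1 * k ∧
      ∀ p, (k : Equiv.Perm (Omega F)) p =
        linForm 1 v 0 1 (u - v ^ 2) v 0 (RingEquiv.refl F) p := by
    intro u v
    refine ⟨gAlpha (u - v ^ 2) v 0 * gGamma v, Subtype.ext (Equiv.ext fun p => ?_), fun p => ?_⟩
    · change alpha u v 0 (tau 1 p) = tau 1 (alpha (u - v ^ 2) v 0 (gamma v p))
      simp only [alpha, tau, gamma, Equiv.coe_fn_mk, Prod.mk.injEq, and_true, one_pow, one_mul]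
      linear_combination (-v * p.2.1) * three_eq_zero (F := F)
    · change alpha (u - v ^ 2) v 0 (gamma v p) = _
      simp [alpha, gamma, linForm]
  have swap : gAlpha (-e') (-e) 0 * gDelta F = gDelta F * gAlpha e (-e') 0 :=
    Subtype.ext (Equiv.ext fun p => by
      change alpha (-e') (-e) 0 (delta F p) = delta F (alpha e (-e') 0 p)
      simp only [alpha, delta, Equiv.coe_fn_mk, Prod.mk.injEq, and_true, true_and]
      ring)
  obtain ⟨k, hk, hk'⟩ := conj (-e') (-e)
  obtain ⟨k', hkk, hkk'⟩ := conj e (-e')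
  have hdet : ∀ y : F, (1 : F) * 1 - y * 0 ≠ 0 := by simp
  have f1 : ∀ u v : F, gAlpha u v 0 • v1 (1 : G F) = v1 1 := fun u v =>
    smul_v1_one_iff.2 (alpha_mem_G1 _ _ _)
  have f2 : ∀ u v : F, gAlpha u v 0 • v2 (1 : G F) = v2 1 := fun u v =>
    smul_v2_one_iff.2 (alpha_mem_G2 _ _ _)
  refine ⟨gAlpha (-e') (-e) 0, fun i => ?_⟩
  fin_cases i
  · change _ • x 0 = gTau (1 : F) • v2 (gGamma 0 * gDelta F)
    rw [h0, smul_smul_of_mul_eq hk, (smul_v2_gamma_delta_iff (hdet _) hk' e 0).2 (by simp)]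
  · change _ • x 1 = v1 (gTau 1)
    rw [h1, ← gTau_smul_v1, smul_smul_of_mul_eq hk, smul_v1_one_of_lin (hdet _) hk']
  · change _ • x 2 = v2 1
    rw [h2, f2]
  · change _ • x 3 = v1 1
    rw [h3, f1]
  · change _ • x 4 = v2 (gGamma 0 * gDelta F)
    rw [h4, v2_gGamma_zero, smul_smul_of_mul_eq swap, f2]
  · change _ • x 5 = gDelta F • v1 (gTau 1)
    rw [h5, smul_smul_of_mul_eq swap, ← gTau_smul_v1, smul_smul_of_mul_eq hkk,
      smul_v1_one_of_lin (hdet _) hkk']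
  · change _ • x 6 = gDelta F • gTau (1 : F) • v2 (gGamma 0 * gDelta F)
    rw [h6, smul_smul_of_mul_eq swap, smul_smul_of_mul_eq hkk,
      (smul_v2_gamma_delta_iff (hdet _) hkk' e' 0).2 (by simp)]

/-- The torus moves the two vertices at distance two from `G₁` in a `6`-arc to standard position:
the exponent matrix `(1, -2; -2, 1)` has determinant `-3`, and cubing is bijective. -/
theorem exists_smul_middle (x : Fin 7 → Vertex F) (hx : IsArc (Delta F) 6 x)
    (h2 : x 2 = stdArc F 2) (h3 : x 3 = stdArc F 3) (h4 : x 4 = stdArc F 4) :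
    ∃ g : G F, ∀ i, g • x i = stdArc F i := by
  change x 2 = v2 1 at h2
  change x 3 = v1 1 at h3
  change x 4 = v2 (gGamma 0 * gDelta F) at h4
  obtain ⟨d, h1⟩ : ∃ d, x 1 = v1 (gTau d) := by
    have hadj := (hx.1 1 2 rfl).symm
    rwa [h2, adj_v2_one_iff] at hadj
  obtain ⟨d', h5⟩ : ∃ d, x 5 = gDelta F • v1 (gTau d) := by
    have hadj := hx.1 4 5 rfl
    rw [h4, v2_gGamma_zero, ← smul_inv_smul (gDelta F) (x 5), adj_smul, adj_v2_one_iff] at hadj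
    obtain ⟨d, hd⟩ := hadj
    exact ⟨d, inv_smul_eq_iff.1 hd⟩
  have hd : d ≠ 0 := by
    rintro rfl
    exact hx.2 1 3 rfl (by rw [h1, h3, v1_one_eq])
  have hd' : d' ≠ 0 := by
    rintro rfl
    exact hx.2 3 5 rfl (by rw [h5, h3, ← v1_one_eq, gDelta_smul_v1])
  -- The solution of `l d = m²`, `m d' = l²`.
  have hl : cubeRoot F (d' ^ 2 * d) ≠ 0 := by simp [hd, hd']
  have hm : cubeRoot F (d' * d ^ 2) ≠ 0 := by simp [hd, hd']
  have e1 : cubeRoot F (d' ^ 2 * d) * d = cubeRoot F (d' * d ^ 2) ^ 2 := by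
    simp only [map_mul, map_pow]
    linear_combination (-cubeRoot F d' ^ 2 * cubeRoot F d) * cubeRoot_pow_three d
  have e2 : cubeRoot F (d' * d ^ 2) * d' = cubeRoot F (d' ^ 2 * d) ^ 2 := by
    simp only [map_mul, map_pow]
    linear_combination (-cubeRoot F d' * cubeRoot F d ^ 2) * cubeRoot_pow_three d'
  obtain ⟨l, hl'⟩ : ∃ l : Fˣ, (l : F) = cubeRoot F (d' ^ 2 * d) := ⟨Units.mk0 _ hl, rfl⟩
  obtain ⟨m, hm'⟩ : ∃ m : Fˣ, (m : F) = cubeRoot F (d' * d ^ 2) := ⟨Units.mk0 _ hm, rfl⟩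
  rw [← hl', ← hm'] at e1 e2
  have swap : gBeta l m * gDelta F = gDelta F * gBeta m l :=
    Subtype.ext (Equiv.ext fun p => by
      change beta l m (delta F p) = delta F (beta m l p)
      simp [beta, delta, mul_comm])
  have f2 : ∀ l m : Fˣ, gBeta l m • v2 (1 : G F) = v2 1 := fun l m =>
    smul_v2_one_iff.2 (beta_mem_G2 _ _)
  have h1' : gBeta l m • x 1 = v1 (gTau 1) := by
    rw [h1, smul_v1_tau_iff l.ne_zero m.ne_zero (beta_apply_quad l m)]
    simpa using e1
  have h5' : gBeta l m • x 5 = gDelta F • v1 (gTau 1) := by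
    rw [h5, smul_smul_of_mul_eq swap,
      (smul_v1_tau_iff m.ne_zero l.ne_zero (beta_apply_quad m l) d' 1).2 (by simpa using e2)]
  obtain ⟨g, hg⟩ := exists_smul_ends (fun i => gBeta l m • x i) (hx.smul adj_smul _) h1'
    (by rw [h2]; exact f2 _ _) (by rw [h3]; exact smul_v1_one_iff.2 (beta_mem_G1 _ _))
    (by rw [h4, v2_gGamma_zero, smul_smul_of_mul_eq swap, f2]; exact v2_gGamma_zero.symm) h5'
  exact ⟨g * gBeta l m, fun i => by rw [mul_smul, hg]⟩

theorem exists_smul_eq_stdArc (x : Fin 7 → Vertex F) (hx : IsArc (Delta F) 6 x)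
    (h0 : x 0 ∈ Set.range Sum.inr) : ∃ g : G F, ∀ i, g • x i = stdArc F i := by
  have hx1 := mem_range_inl_of_adj h0 (hx.1 0 1 rfl)
  have hx2 := mem_range_inr_of_adj hx1 (hx.1 1 2 rfl)
  have hx3 := mem_range_inl_of_adj hx2 (hx.1 2 3 rfl)
  obtain ⟨g, h3, h2⟩ := exists_smul_of_adj hx3 (hx.1 2 3 rfl).symm
  obtain ⟨e, h4⟩ : ∃ e, x 4 = g • v2 (gGamma e * gDelta F) := by
    have hadj := hx.1 3 4 rfl
    have hne := hx.2 2 4 rfl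
    rw [h3, ← smul_inv_smul g (x 4), adj_smul, adj_v1_one_iff] at hadj
    obtain h | ⟨e, h⟩ := hadj
    · rw [inv_smul_eq_iff] at h
      exact absurd (h2.trans h.symm) hne
    · exact ⟨e, inv_smul_eq_iff.1 h⟩
  obtain ⟨k, hk⟩ := exists_smul_middle (fun i => (gGamma (-e) * g⁻¹) • x i)
    (hx.smul adj_smul _)
    (by
      rw [h2, mul_smul, inv_smul_smul]
      exact (smul_v2_one_iff (g := gGamma _)).2 (gamma_mem_G2 _))
    (by
      rw [h3, mul_smul, inv_smul_smul]
      exact (smul_v1_one_iff (g := gGamma _)).2 (gamma_mem_G1 _))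
    (by
      rw [h4, mul_smul, inv_smul_smul,
        (smul_v2_gamma_delta_iff (by simp) (gamma_apply_lin (-e)) e 0).2 (by simp)]
      rfl)
  exact ⟨k * (gGamma (-e) * g⁻¹), fun i => by rw [mul_smul, hk]⟩

theorem arcTransitiveAt_six {z : Vertex F} (hz : z ∈ Set.range Sum.inr) :
    ArcTransitiveAt (G F) (Delta F) 6 z :=
  arcTransitiveAt_of_standard (stdArc F) fun x hx h0 => exists_smul_eq_stdArc x hx (h0 ▸ hz)

theorem two_lt_card : 2 < Nat.card F := by
  have := Fintype.ofFinite F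
  obtain ⟨n, -, hn⟩ := FiniteField.card F 3
  rw [Nat.card_eq_fintype_card, hn]
  calc 2 < 3 ^ 1 := by norm_num
    _ ≤ 3 ^ (n : ℕ) := Nat.pow_le_pow_right (by norm_num) n.pos

theorem exists_adj_ne (z y : Vertex F) : ∃ w, (Delta F).Adj z w ∧ w ≠ y := by
  have hc : 1 < ((Delta F).neighborSet z).ncard := by
    have := two_lt_card (F := F)
    rcases z with z | z
    · obtain ⟨g, hg⟩ := exists_eq_smul_v1 z
      rw [hg, ncard_neighborSet_smul adj_smul, ncard_neighborSet_v1]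
      omega
    · obtain ⟨g, hg⟩ := exists_eq_smul_v2 z
      rw [hg, ncard_neighborSet_smul adj_smul, ncard_neighborSet_v2]
      omega
  obtain ⟨w, hw, hne⟩ := Set.exists_ne_of_one_lt_ncard hc y
  exact ⟨w, hw, hne⟩

theorem locallyArcTransitive_five : LocallyArcTransitive (G F) (Delta F) 5 := by
  intro z
  rcases z with z | z
  · refine arcTransitiveAt_of_standard (fun i => stdArc F i.succ) fun x hx h0 => ?_
    obtain ⟨w, hw, hne⟩ := exists_adj_ne (x 0) (x 1)
    obtain ⟨g, hg⟩ := exists_smul_eq_stdArc _ (hx.cons hw.symm hne)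
      (mem_range_inr_of_adj ⟨z, h0.symm⟩ hw)
    exact ⟨g, fun i => by rw [← hg, Fin.cons_succ]⟩
  · refine arcTransitiveAt_of_standard (fun i => stdArc F i.castSucc) fun x hx h0 => ?_
    obtain ⟨w, hw, hne⟩ := exists_adj_ne (x (Fin.last 5)) (x (Fin.last 4).castSucc)
    obtain ⟨g, hg⟩ := exists_smul_eq_stdArc _ (hx.snoc hw hne.symm) ⟨z, h0.symm⟩
    exact ⟨g, fun i => by rw [← hg, Fin.snoc_castSucc]⟩

end ArcsDelta

/-! ### Local kernels and pushing up -/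

section LocalKernel

variable {F : Type*} [Field F] [Finite F] [CharP F 3]

theorem exists_linForm {x y z t : F} (h : x * t - y * z ≠ 0) (u v w : F) (s : F ≃+* F) :
    ∃ g ∈ G1 F, ∀ p, g p = linForm x y z t u v w s p := by
  have hinj : Function.Injective (linForm x y z t u v w s) := by
    rintro ⟨a, b, c⟩ ⟨a', b', c'⟩ he
    simp only [linForm, Prod.mk.injEq] at he
    obtain ⟨h1, h2, h3⟩ := he
    have ha : (x * t - y * z) * (s a - s a') = 0 := by linear_combination t * h1 - y * h2
    have hb : (x * t - y * z) * (s b - s b') = 0 := by linear_combination x * h2 - z * h1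
    have hk : cubeRoot F (x * t - y * z) ^ 2 ≠ 0 := pow_ne_zero _ ((map_ne_zero _).2 h)
    rw [mul_eq_zero, or_iff_right h, sub_eq_zero] at ha hb
    have hc := mul_left_cancel₀ hk (add_right_cancel h3)
    rw [s.injective ha, s.injective hb, s.injective hc]
  let g := Equiv.ofBijective _ (Finite.injective_iff_bijective.1 hinj)
  exact ⟨g, mem_G1_iff.2 ⟨x, y, z, t, u, v, w, s, h, fun _ => rfl⟩, fun _ => rfl⟩

theorem exists_quadForm {l m : F} (hl : l ≠ 0) (hm : m ≠ 0) (d e u v w : F) (s : F ≃+* F) :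
    ∃ g ∈ G2 F, ∀ p, g p = quadForm l m d e u v w s p := by
  have hinj : Function.Injective (quadForm l m d e u v w s) := by
    rintro ⟨a, b, c⟩ ⟨a', b', c'⟩ he
    simp only [quadForm, Prod.mk.injEq] at he
    obtain ⟨h1, h2, h3⟩ := he
    have hk : cubeRoot F (l * m) ^ 2 ≠ 0 := pow_ne_zero _ ((map_ne_zero _).2 (mul_ne_zero hl hm))
    have hb := s.injective (mul_left_cancel₀ hm (add_right_cancel h2))
    have hc := s.injective (mul_left_cancel₀ hk (add_right_cancel h3))
    subst hb hc
    have ha : l * s a = l * s a' := by linear_combination h1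
    rw [s.injective (mul_left_cancel₀ hl ha)]
  let g := Equiv.ofBijective _ (Finite.injective_iff_bijective.1 hinj)
  exact ⟨g, mem_G2_iff.2 ⟨l, m, d, e, u, v, w, s, hl, hm, fun _ => rfl⟩, fun _ => rfl⟩

theorem mem_localKernel_v1 {g : G F} : g ∈ localKernel (G F) (Delta F) (v1 1) ↔
    ∃ x u v w, x ≠ 0 ∧
      ∀ p, (g : Equiv.Perm (Omega F)) p = linForm x 0 0 x u v w (RingEquiv.refl F) p := by
  simp only [mem_localKernel, adj_v1_one_iff, smul_v1_one_iff]
  constructor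
  · rintro ⟨h1, h2⟩
    obtain ⟨x, y, z, t, u, v, w, s, h, hg⟩ := mem_G1_iff.1 h1
    have hz := (smul_v2_one_iff_of_linForm h hg).1 (h2 _ (Or.inl rfl))
    have he := fun e => (smul_v2_gamma_delta_iff h hg e e).1 (h2 _ (Or.inr ⟨e, rfl⟩))
    subst hz
    have hy : y = 0 := by simpa using he 0
    subst hy
    have hxt : x = t := by simpa using he 1
    subst hxt
    have hx : x ≠ 0 := by
      rintro rfl
      simp at h
    have hs : s = RingEquiv.refl F := RingEquiv.ext fun e => by
      have := he e
      refine mul_left_cancel₀ hx (Eq.trans ?_ (this.trans ?_)) <;> simp [mul_comm]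
    subst hs
    exact ⟨x, u, v, w, hx, hg⟩
  · rintro ⟨x, u, v, w, hx, hg⟩
    have hdet : x * x - 0 * 0 ≠ 0 := by simpa using hx
    refine ⟨mem_G1_iff.2 ⟨_, _, _, _, _, _, _, _, hdet, hg⟩, ?_⟩
    rintro _ (rfl | ⟨e, rfl⟩)
    · exact (smul_v2_one_iff_of_linForm hdet hg).2 rfl
    · rw [smul_v2_gamma_delta_iff hdet hg]
      simp [mul_comm]

theorem mem_localKernel_v2 {g : G F} : g ∈ localKernel (G F) (Delta F) (v2 1) ↔
    ∃ m e u v w, m ≠ 0 ∧ ∀ p, (g : Equiv.Perm (Omega F)) p =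
      quadForm (m ^ 2) m 0 e u v w (RingEquiv.refl F) p := by
  simp only [mem_localKernel, adj_v2_one_iff, smul_v2_one_iff]
  constructor
  · rintro ⟨h1, h2⟩
    obtain ⟨l, m, d, e, u, v, w, s, hl, hm, hg⟩ := mem_G2_iff.1 h1
    have he := fun e => (smul_v1_tau_iff hl hm hg e e).1 (h2 _ ⟨e, rfl⟩)
    have hd : d = 0 := by simpa using he 0
    subst hd
    have hlm : l = m ^ 2 := by simpa using he 1
    subst hlm
    have hs : s = RingEquiv.refl F := RingEquiv.ext fun e => by
      refine mul_left_cancel₀ hl (Eq.trans ?_ ((he e).trans ?_)) <;> simp [mul_comm]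
    subst hs
    exact ⟨m, e, u, v, w, hm, hg⟩
  · rintro ⟨m, e, u, v, w, hm, hg⟩
    have hm2 := pow_ne_zero 2 hm
    refine ⟨mem_G2_iff.2 ⟨_, _, _, _, _, _, _, _, hm2, hm, hg⟩, ?_⟩
    rintro _ ⟨d, rfl⟩
    rw [smul_v1_tau_iff hm2 hm hg]
    simp [mul_comm]

variable (F) in
/-- The subgroup `A` of translations, inside `G`. -/
def subA : Subgroup (G F) where
  carrier := {g | ∃ u v w, ∀ p, (g : Equiv.Perm (Omega F)) p = (p.1 + u, p.2.1 + v, p.2.2 + w)}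
  one_mem' := ⟨0, 0, 0, fun p => by simp⟩
  mul_mem' := by
    rintro a b ⟨u, v, w, ha⟩ ⟨u', v', w', hb⟩
    exact ⟨u' + u, v' + v, w' + w, fun p => by
      rw [Subgroup.coe_mul, Equiv.Perm.mul_apply, hb, ha]
      simp only [add_assoc]⟩
  inv_mem' := by
    rintro a ⟨u, v, w, ha⟩
    exact ⟨-u, -v, -w, fun p => by
      rw [Subgroup.coe_inv, Equiv.Perm.inv_eq_iff_eq, ha]
      simp⟩

variable (F) in
/-- The subgroup `Q = ⟨A, C⟩`, inside `G`. -/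
def subQ : Subgroup (G F) where
  carrier := {g | ∃ e u v w, ∀ p, (g : Equiv.Perm (Omega F)) p =
    (p.1 + e * p.2.1 + u, p.2.1 + v, p.2.2 + w)}
  one_mem' := ⟨0, 0, 0, 0, fun p => by simp⟩
  mul_mem' := by
    rintro a b ⟨e, u, v, w, ha⟩ ⟨e', u', v', w', hb⟩
    exact ⟨e' + e, u' + e * v' + u, v' + v, w' + w, fun p => by
      rw [Subgroup.coe_mul, Equiv.Perm.mul_apply, hb, ha]
      simp only [Prod.mk.injEq]
      refine ⟨?_, ?_, ?_⟩ <;> ring⟩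
  inv_mem' := by
    rintro a ⟨e, u, v, w, ha⟩
    exact ⟨-e, -u + e * v, -v, -w, fun p => by
      rw [Subgroup.coe_inv, Equiv.Perm.inv_eq_iff_eq, ha]
      obtain ⟨a, b, c⟩ := p
      simp only [Prod.mk.injEq]
      refine ⟨?_, ?_, ?_⟩ <;> ring⟩

theorem subA_le_subQ : subA F ≤ subQ F := by
  rintro g ⟨u, v, w, hg⟩
  exact ⟨0, u, v, w, fun p => by simp [hg]⟩

theorem gAlpha_mem_subA (u v w : F) : gAlpha u v w ∈ subA F := ⟨u, v, w, fun _ => rfl⟩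

theorem isPGroup_subQ : IsPGroup 3 (subQ F) := by
  rintro ⟨g, e, u, v, w, hg⟩
  refine ⟨1, Subtype.ext (Subtype.ext
        (Equiv.ext fun p => ?_))⟩
  change ((g : Equiv.Perm (Omega F)) ^ 3 ^ 1) p = p
  rw [pow_one, pow_succ, pow_two, Equiv.Perm.mul_apply, Equiv.Perm.mul_apply, hg, hg, hg]
  obtain ⟨a, b, c⟩ := p
  simp only [Prod.mk.injEq]
  have h3 := three_eq_zero (F := F)
  refine ⟨?_, ?_, ?_⟩
  · linear_combination (e * b + u + e * v) * h3
  · linear_combination v * h3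
  · linear_combination w * h3

theorem isPGroup_subA : IsPGroup 3 (subA F) := isPGroup_subQ.to_le subA_le_subQ

/-- `A` is regular and abelian, hence its own centralizer in the symmetric group. -/
theorem mem_subA_of_commute {g : G F} (h : ∀ a ∈ subA F, a * g = g * a) : g ∈ subA F := by
  refine ⟨((g : Equiv.Perm (Omega F)) (0, 0, 0)).1, ((g : Equiv.Perm (Omega F)) (0, 0, 0)).2.1,
    ((g : Equiv.Perm (Omega F)) (0, 0, 0)).2.2, fun p => ?_⟩
  have := congrArg (fun k : G F => (k : Equiv.Perm (Omega F)) (0, 0, 0))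
    (h _ (gAlpha_mem_subA p.1 p.2.1 p.2.2))
  have h2 : alpha p.1 p.2.1 p.2.2 (((g : Equiv.Perm (Omega F))) (0, 0, 0)) =
      (g : Equiv.Perm (Omega F)) (alpha p.1 p.2.1 p.2.2 (0, 0, 0)) := this
  simp only [alpha, Equiv.coe_fn_mk, zero_add] at h2
  rw [show p = (p.1, p.2.1, p.2.2) from rfl, ← h2]
  simp only [add_comm]

theorem subA_le_localKernel : subA F ≤ localKernel (G F) (Delta F) (v1 1) := by
  rintro g ⟨u, v, w, hg⟩
  exact mem_localKernel_v1.2 ⟨1, u, v, w, one_ne_zero, fun p => by simp [hg, linForm]⟩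

theorem subQ_le_localKernel : subQ F ≤ localKernel (G F) (Delta F) (v2 1) := by
  rintro g ⟨e, u, v, w, hg⟩
  exact mem_localKernel_v2.2 ⟨1, e, u, v, w, one_ne_zero, fun p => by simp [hg, quadForm]⟩

theorem subA_normal {h a : G F} (hh : h ∈ localKernel (G F) (Delta F) (v1 1)) (ha : a ∈ subA F) :
    h * a * h⁻¹ ∈ subA F := by
  have hk := mul_mem (mul_mem hh (subA_le_localKernel ha)) (inv_mem hh)
  have hc : ∀ p, ((h * a * h⁻¹ : G F) : Equiv.Perm (Omega F)) ((h : Equiv.Perm (Omega F)) p) =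
      (h : Equiv.Perm (Omega F)) ((a : Equiv.Perm (Omega F)) p) := fun p => by
    simp [Equiv.Perm.mul_apply]
  generalize h * a * h⁻¹ = k at hk hc
  obtain ⟨x', u', v', w', -, hk⟩ := mem_localKernel_v1.1 hk
  obtain ⟨x, u, v, w, hx, hh⟩ := mem_localKernel_v1.1 hh
  obtain ⟨u₁, v₁, w₁, ha⟩ := ha
  have h0 := congrArg Prod.fst (hc (0, 0, 0))
  have h1 := congrArg Prod.fst (hc (1, 0, 0))
  simp only [hk, hh, ha, linForm, RingEquiv.refl_apply] at h0 h1
  have hx' : x' = 1 := mul_right_cancel₀ hx (by linear_combination h1 - h0)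
  subst hx'
  exact ⟨u', v', w', fun p => by simp [hk, linForm]⟩

theorem subQ_normal {h a : G F} (hh : h ∈ localKernel (G F) (Delta F) (v2 1)) (ha : a ∈ subQ F) :
    h * a * h⁻¹ ∈ subQ F := by
  have hk := mul_mem (mul_mem hh (subQ_le_localKernel ha)) (inv_mem hh)
  have hc : ∀ p, ((h * a * h⁻¹ : G F) : Equiv.Perm (Omega F)) ((h : Equiv.Perm (Omega F)) p) =
      (h : Equiv.Perm (Omega F)) ((a : Equiv.Perm (Omega F)) p) := fun p => by
    simp [Equiv.Perm.mul_apply]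
  generalize h * a * h⁻¹ = k at hk hc
  obtain ⟨x', e', u', v', w', -, hk⟩ := mem_localKernel_v2.1 hk
  obtain ⟨x, e, u, v, w, hx, hh⟩ := mem_localKernel_v2.1 hh
  obtain ⟨e₁, u₁, v₁, w₁, ha⟩ := ha
  have h0 := congrArg (fun p => p.2.1) (hc (0, 0, 0))
  have h1 := congrArg (fun p => p.2.1) (hc (0, 1, 0))
  simp only [hk, hh, ha, quadForm, RingEquiv.refl_apply] at h0 h1
  have hx' : x' = 1 := mul_right_cancel₀ hx (by linear_combination h1 - h0)
  subst hx'
  exact ⟨e', u', v', w', fun p => by simp [hk, quadForm]⟩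

theorem mem_subA_of_pow_eq_one {g : G F} (hg : g ∈ localKernel (G F) (Delta F) (v1 1)) {k : ℕ}
    (hk : g ^ 3 ^ k = 1) : g ∈ subA F := by
  obtain ⟨x, u, v, w, -, hg⟩ := mem_localKernel_v1.1 hg
  have hpow : ∀ n : ℕ, ∃ u', ∀ p,
      (((g ^ n : G F) : Equiv.Perm (Omega F)) p).1 = x ^ n * p.1 + u' := by
    intro n
    induction n with
    | zero => exact ⟨0, fun p => by simp⟩
    | succ n ih =>
      obtain ⟨u', ih⟩ := ih
      refine ⟨x * u' + u, fun p => ?_⟩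
      rw [pow_succ', Subgroup.coe_mul, Equiv.Perm.mul_apply, hg]
      simp only [linForm, RingEquiv.refl_apply, ih]
      ring
  obtain ⟨u', h⟩ := hpow (3 ^ k)
  rw [hk] at h
  have h0 := h (0, 0, 0)
  have h1 := h (1, 0, 0)
  simp only [Subgroup.coe_one, Equiv.Perm.one_apply] at h0 h1
  have hx : x = 1 := pow_three_pow_eq_one (k := k) (by linear_combination h0 - h1)
  subst hx
  exact ⟨u, v, w, fun p => by simp [hg, linForm]⟩

theorem mem_map_conj {Γ : Type*} [Group Γ] {N : Subgroup Γ} {g x : Γ} :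
    x ∈ N.map (MulAut.conj g).toMonoidHom ↔ g⁻¹ * x * g ∈ N := by
  exact Subgroup.mem_map_equiv.trans (by rw [MulAut.conj_symm_apply])

/-- The conjugate by `g` of a normal `3`-subgroup of the local kernel of `z` is one of the local
kernel of `g • z`. -/
theorem map_conj_le_pCore {N : Subgroup (G F)} {z : Vertex F}
    (hN : N ≤ localKernel (G F) (Delta F) z)
    (hn : ∀ h ∈ localKernel (G F) (Delta F) z, ∀ x ∈ N, h * x * h⁻¹ ∈ N) (hp : IsPGroup 3 N)
    (g : G F) : N.map (MulAut.conj g).toMonoidHom ≤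
      pCore 3 (localKernel (G F) (Delta F) (g • z)) := by
  refine le_pCore (fun x hx => ?_) (fun h hh x hx => ?_) (hp.map _)
  · rw [mem_map_conj] at hx
    exact (mem_localKernel_smul adj_smul).2 (hN hx)
  · rw [mem_map_conj] at hx ⊢
    rw [mem_localKernel_smul adj_smul] at hh
    have := hn _ hh _ hx
    convert this using 1
    group

theorem centralizer_pCore_le {N : Subgroup (G F)} {z : Vertex F} (hA : subA F ≤ N)
    (hN : N ≤ localKernel (G F) (Delta F) z)
    (hn : ∀ h ∈ localKernel (G F) (Delta F) z, ∀ x ∈ N, h * x * h⁻¹ ∈ N) (hp : IsPGroup 3 N)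
    (g : G F) :
    Subgroup.centralizer (pCore 3 (localKernel (G F) (Delta F) (g • z)) : Set (G F)) ≤
      pCore 3 (localKernel (G F) (Delta F) (g • z)) := by
  have hle := map_conj_le_pCore hN hn hp g
  intro x hx
  refine hle (mem_map_conj.2 (hA (mem_subA_of_commute fun a ha => ?_)))
  have := Subgroup.mem_centralizer_iff.1 hx (g * a * g⁻¹) (hle (mem_map_conj.2 (hA (by
    convert ha using 1
    group))))
  calc a * (g⁻¹ * x * g) = g⁻¹ * (g * a * g⁻¹ * x) * g := by group
    _ = g⁻¹ * (x * (g * a * g⁻¹)) * g := by rw [this]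
    _ = g⁻¹ * x * g * a := by group

theorem localCharacteristic_three : LocalCharacteristic (G F) (Delta F) 3 := by
  refine ⟨Nat.prime_three, fun z => inf_le_left.trans ?_⟩
  rcases z with z | z
  · obtain ⟨g, hg⟩ := exists_eq_smul_v1 z
    rw [hg]
    exact centralizer_pCore_le le_rfl subA_le_localKernel (fun _ hh _ hx => subA_normal hh hx)
      isPGroup_subA g
  · obtain ⟨g, hg⟩ := exists_eq_smul_v2 z
    rw [hg]
    exact centralizer_pCore_le subA_le_subQ subQ_le_localKernel
      (fun _ hh _ hx => subQ_normal hh hx) isPGroup_subQ g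

theorem isLocallyFinite : IsLocallyFinite (G F) (Vertex F) := fun _ => inferInstance

theorem pushingUpType {x₁ x₂ : Vertex F} (h₁ : x₁ ∈ Set.range Sum.inl)
    (h : (Delta F).Adj x₁ x₂) : PushingUpType (G F) (Delta F) 3 x₁ x₂ := by
  refine ⟨isLocallyFinite, h, localCharacteristic_three, ?_⟩
  obtain ⟨g, rfl, rfl⟩ := exists_smul_of_adj h₁ h
  refine le_trans (pCore_le fun x hx hk => ?_)
    (map_conj_le_pCore subQ_le_localKernel (fun _ hh _ hx => subQ_normal hh hx) isPGroup_subQ g)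
  obtain ⟨k, hk⟩ := hk
  rw [mem_localKernel_smul adj_smul] at hx
  refine mem_map_conj.2 (subA_le_subQ (mem_subA_of_pow_eq_one (k := k) hx ?_))
  have := conj_pow (i := 3 ^ k) (a := g⁻¹) (b := x)
  rw [inv_inv] at this
  rw [this, hk]
  group

theorem faithful : FaithfulSMul (G F) (Vertex F) := by
  -- An element fixing all vertices is a translation, since it lies in both local kernels.
  have hA : ∀ g : G F, (∀ z : Vertex F, g • z = z) → g ∈ subA F := by
    intro g hg
    obtain ⟨x, u, v, w, hx, h1⟩ :=
      mem_localKernel_v1.1 (mem_localKernel.2 ⟨hg (v1 1), fun z _ => hg z⟩)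
    obtain ⟨m, e, u', v', w', hm, h2⟩ :=
      mem_localKernel_v2.1 (mem_localKernel.2 ⟨hg (v2 1), fun z _ => hg z⟩)
    have e0 := (h1 (0, 0, 0)).symm.trans (h2 (0, 0, 0))
    have e1 := (h1 (1, 0, 0)).symm.trans (h2 (1, 0, 0))
    have e2 := (h1 (0, 1, 0)).symm.trans (h2 (0, 1, 0))
    simp only [linForm, quadForm, RingEquiv.refl_apply, Prod.mk.injEq] at e0 e1 e2
    have hxm : x = m ^ 2 := by linear_combination e1.1 - e0.1
    have hxm' : x = m := by linear_combination e2.2.1 - e0.2.1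
    have : m = 1 := mul_left_cancel₀ hm (by linear_combination hxm' - hxm)
    rw [hxm', this] at h1
    exact ⟨u, v, w, fun p => by simp [h1, linForm]⟩
  have hconj : ∀ g h : G F, (∀ z : Vertex F, g • z = z) → ∀ z : Vertex F, (h⁻¹ * g * h) • z = z :=
    fun g h hg z => by rw [mul_smul, mul_smul, hg, inv_smul_smul]
  -- Conjugation by `τ_1` adds `γ_{-2v}` to a translation, and conjugation by `δ` swaps `u` and
  -- `v` up to sign.
  have hv : ∀ g : G F, (∀ z : Vertex F, g • z = z) → ∀ u v w : F,
      (∀ p, (g : Equiv.Perm (Omega F)) p = (p.1 + u, p.2.1 + v, p.2.2 + w)) → v = 0 := by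
    intro g hg u v w hp
    obtain ⟨u', v', w', h'⟩ := hA _ (hconj g (gTau 1) hg)
    have key : ∀ p, (((gTau 1)⁻¹ * g * gTau 1 : G F) : Equiv.Perm (Omega F)) p =
        tau (-1) ((g : Equiv.Perm (Omega F)) (tau 1 p)) := fun p => by rw [← tau_inv]; rfl
    have e0 := congrArg Prod.fst ((h' (0, 0, 0)).symm.trans (key (0, 0, 0)))
    have e1 := congrArg Prod.fst ((h' (0, 1, 0)).symm.trans (key (0, 1, 0)))
    simp only [hp, tau_apply_quad, quadForm, RingEquiv.refl_apply] at e0 e1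
    linear_combination v * three_eq_zero (F := F) + e0 - e1
  have hu : ∀ g : G F, (∀ z : Vertex F, g • z = z) → ∀ u v w : F,
      (∀ p, (g : Equiv.Perm (Omega F)) p = (p.1 + u, p.2.1 + v, p.2.2 + w)) → u = 0 := by
    intro g hg u v w hp
    have := hv _ (hconj g (gDelta F) hg) (-v) u w fun p => by
      change (delta F)⁻¹ ((g : Equiv.Perm (Omega F)) (delta F p)) = _
      rw [hp, delta_inv_apply]
      simp [delta, add_comm]
    exact this
  have hw : ∀ g : G F, (∀ z : Vertex F, g • z = z) → ∀ u v w : F,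
      (∀ p, (g : Equiv.Perm (Omega F)) p = (p.1 + u, p.2.1 + v, p.2.2 + w)) → w = 0 := by
    intro g hg u v w hp
    have hv0 := hv g hg u v w hp
    have hu0 := hu g hg u v w hp
    have key : ∀ p, (((gTau 1)⁻¹ * g * gTau 1 : G F) : Equiv.Perm (Omega F)) p =
        tau (-1) ((g : Equiv.Perm (Omega F)) (tau 1 p)) := fun p => by rw [← tau_inv]; rfl
    have := hu _ (hconj g (gTau 1) hg) (-w) 0 w fun p => by
      rw [key, hp, hv0, hu0, tau_apply_quad, tau_apply_quad]
      simp only [quadForm, RingEquiv.refl_apply, map_neg, map_one, one_pow, mul_one, one_mul,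
        Prod.mk.injEq]
      refine ⟨?_, ?_, ?_⟩ <;> ring
    simpa using this
  have main : ∀ g : G F, (∀ z : Vertex F, g • z = z) → g = 1 := by
    intro g hg
    obtain ⟨u, v, w, h⟩ := hA g hg
    obtain rfl := hu g hg u v w h
    obtain rfl := hv g hg _ v w h
    obtain rfl := hw g hg _ _ w h
    exact Subtype.ext (Equiv.ext fun p => by simp [h])
  refine ⟨fun {g h} hgh => ?_⟩
  have := main (h⁻¹ * g) fun z => by rw [mul_smul, hgh, inv_smul_smul]
  exact (inv_mul_eq_one.1 this).symm

theorem isGGraph : IsGGraph (G F) (Delta F) where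
  finite := inferInstance
  connected := by
    refine cosetGraph_connected ?_
    rw [← Subgroup.subgroupOf_sup G1_le_G G2_le_G]
    exact Subgroup.subgroupOf_self _
  adj_smul := adj_smul
  faithful := faithful

end LocalKernel

/-! ### The semilinear groups in coordinates -/

section Semilinear

variable {F : Type*} [Field F]

/-- The semilinear map of `F²` with matrix `(x, y; z, t)` and field automorphism `s`. -/
def semi (x y z t : F) (s : F ≃+* F) (q : Fin 2 → F) : Fin 2 → F :=
  ![x * s (q 0) + y * s (q 1), z * s (q 0) + t * s (q 1)]

theorem semi_semi (x y z t x' y' z' t' : F) (s s' : F ≃+* F) (q : Fin 2 → F) :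
    semi x' y' z' t' s' (semi x y z t s q) =
      semi (x' * s' x + y' * s' z) (x' * s' y + y' * s' t) (z' * s' x + t' * s' z)
        (z' * s' y + t' * s' t) (s.trans s') q := by
  ext i
  fin_cases i <;> simp [semi] <;> ring

theorem semi_congr {x y z t x' y' z' t' : F} {s : F ≃+* F} (q : Fin 2 → F) (hx : x = x')
    (hy : y = y') (hz : z = z') (ht : t = t') : semi x y z t s q = semi x' y' z' t' s q := by
  rw [hx, hy, hz, ht]

theorem semi_unique {x y z t x' y' z' t' : F} {s s' : F ≃+* F} (h : x * t - y * z ≠ 0)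
    (he : ∀ q, semi x y z t s q = semi x' y' z' t' s' q) :
    x = x' ∧ y = y' ∧ z = z' ∧ t = t' ∧ s = s' := by
  have h10 := he ![1, 0]
  have h01 := he ![0, 1]
  simp only [semi, Matrix.cons_val_zero, Matrix.cons_val_one, map_one, map_zero, mul_one, mul_zero,
    add_zero, zero_add, Matrix.vecCons_inj] at h10 h01
  obtain ⟨rfl, rfl, -⟩ := h10
  obtain ⟨rfl, rfl, -⟩ := h01
  refine ⟨rfl, rfl, rfl, rfl, RingEquiv.ext fun a => ?_⟩
  have ha := he ![a, 0]
  simp only [semi, Matrix.cons_val_zero, Matrix.cons_val_one, map_zero, mul_zero,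
    add_zero, Matrix.vecCons_inj, mul_eq_mul_left_iff] at ha
  obtain ⟨h1 | rfl, h2 | rfl, -⟩ := ha
  · exact h1
  · exact h1
  · exact h2
  · simp at h

theorem semi_injective {x y z t : F} (h : x * t - y * z ≠ 0) (s : F ≃+* F) :
    Function.Injective (semi x y z t s) := by
  intro q q' he
  simp only [semi, Matrix.vecCons_inj, and_true] at he
  obtain ⟨h1, h2⟩ := he
  have ha : (x * t - y * z) * (s (q 0) - s (q' 0)) = 0 := by linear_combination t * h1 - y * h2
  have hb : (x * t - y * z) * (s (q 1) - s (q' 1)) = 0 := by linear_combination x * h2 - z * h1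
  rw [mul_eq_zero, or_iff_right h, sub_eq_zero] at ha hb
  ext i
  fin_cases i
  · exact s.injective ha
  · exact s.injective hb

theorem mem_GammaL_of_semi {f : Equiv.Perm (Fin 2 → F)} {x y z t : F} {s : F ≃+* F}
    (hf : ∀ q, f q = semi x y z t s q) : f ∈ GammaL F (Fin 2 → F) := by
  refine ⟨fun v w => ?_, s, fun c v => ?_⟩
  · simp only [hf]
    ext i
    fin_cases i <;> simp [semi] <;> ring
  · simp only [hf]
    ext i
    fin_cases i <;> simp [semi] <;> ring

theorem exists_semi_of_mem_GammaL {f : Equiv.Perm (Fin 2 → F)} (hf : f ∈ GammaL F (Fin 2 → F)) :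
    ∃ x y z t s, x * t - y * z ≠ 0 ∧ ∀ q, f q = semi x y z t s q := by
  obtain ⟨hadd, s, hs⟩ := hf
  have key : ∀ q, f q = semi (f ![1, 0] 0) (f ![0, 1] 0) (f ![1, 0] 1) (f ![0, 1] 1) s q := by
    intro q
    have hq : q = q 0 • ![1, 0] + q 1 • ![0, 1] := by
      ext i
      fin_cases i <;> simp
    conv_lhs => rw [hq, hadd, hs, hs]
    ext i
    fin_cases i <;> simp [semi, mul_comm]
  generalize f ![1, 0] 0 = x at key
  generalize f ![0, 1] 0 = y at key
  generalize f ![1, 0] 1 = z at key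
  generalize f ![0, 1] 1 = t at key
  refine ⟨x, y, z, t, s, fun hdet => ?_, key⟩
  -- If the determinant vanishes, `f` kills the two columns of the adjugate matrix.
  have h0 : f 0 = 0 := by simp [key, semi]
  have kill : ∀ a b, x * a + y * b = 0 → z * a + t * b = 0 → a = 0 ∧ b = 0 := by
    intro a b h1 h2
    have : f ![s.symm a, s.symm b] = f 0 := by
      rw [h0, key]
      ext i
      fin_cases i <;> simp [semi, h1, h2]
    have h3 := f.injective this
    have e0 := congrFun h3 0
    have e1 := congrFun h3 1
    simpa using And.intro e0 e1
  obtain ⟨ht, hz⟩ := kill t (-z) (by linear_combination hdet) (by ring)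
  obtain ⟨hy, hx⟩ := kill y (-x) (by ring) (by linear_combination -hdet)
  rw [neg_eq_zero] at hz hx
  have := (kill 1 0 (by simp [hx]) (by simp [hz])).1
  exact one_ne_zero this

variable [Finite F]

theorem exists_semi {x y z t : F} (h : x * t - y * z ≠ 0) (s : F ≃+* F) :
    ∃ f : GammaL F (Fin 2 → F), ∀ q, (f : Equiv.Perm (Fin 2 → F)) q = semi x y z t s q := by
  let f := Equiv.ofBijective _ (Finite.injective_iff_bijective.1 (semi_injective h s))
  exact ⟨⟨f, mem_GammaL_of_semi fun _ => rfl⟩, fun _ => rfl⟩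

end Semilinear

/-! ### The stabilizer of a coset of `G₁` -/

section StabOne

variable {F : Type*} [Field F] [Finite F] [CharP F 3]

/-- An element of `G₁` and its linear part on the first two coordinates. -/
def LinearPart (g : G F) (f : Equiv.Perm (Fin 2 → F)) : Prop :=
  ∃ x y z t u v w s, x * t - y * z ≠ 0 ∧
    (∀ p, (g : Equiv.Perm (Omega F)) p = linForm x y z t u v w s p) ∧ ∀ q, f q = semi x y z t s q

theorem LinearPart.unique {g : G F} {f f' : Equiv.Perm (Fin 2 → F)} (h : LinearPart g f)
    (h' : LinearPart g f') : f = f' := by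
  obtain ⟨x, y, z, t, u, v, w, s, -, hg, hf⟩ := h
  obtain ⟨x', y', z', t', u', v', w', s', -, hg', hf'⟩ := h'
  refine Equiv.ext fun q => ?_
  have e0 := (hg (0, 0, 0)).symm.trans (hg' (0, 0, 0))
  have e1 := (hg (q 0, q 1, 0)).symm.trans (hg' (q 0, q 1, 0))
  simp only [linForm, map_zero, Prod.mk.injEq] at e0 e1
  rw [hf, hf']
  simp only [semi, Matrix.vecCons_inj, and_true]
  exact ⟨by linear_combination e1.1 - e0.1, by linear_combination e1.2.1 - e0.2.1⟩

variable (F) in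
/-- The projection of the stabilizer of `G₁` onto `ΓL₂`, with its section. -/
theorem exists_linearPart_hom :
    ∃ (π : MulAction.stabilizer (G F) (v1 (1 : G F)) →* GammaL F (Fin 2 → F))
      (σ : GammaL F (Fin 2 → F) →* MulAction.stabilizer (G F) (v1 (1 : G F))),
      (∀ g : MulAction.stabilizer (G F) (v1 (1 : G F)), LinearPart (g : G F) (π g)) ∧
        ∀ f, π (σ f) = f := by
  obtain ⟨π, hπ⟩ := exists_hom_of_rel
    (fun (g : MulAction.stabilizer (G F) (v1 (1 : G F))) (f : GammaL F (Fin 2 → F)) =>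
      LinearPart (g : G F) (f : Equiv.Perm (Fin 2 → F)))
    (fun g => by
      obtain ⟨x, y, z, t, u, v, w, s, h, hg⟩ := mem_G1_iff.1 (smul_v1_one_iff.1 g.2)
      obtain ⟨f, hf⟩ := exists_semi h s
      exact ⟨f, x, y, z, t, u, v, w, s, h, hg, hf⟩)
    (fun g' g f' f => by
      rintro ⟨x', y', z', t', u', v', w', s', h', hg', hf'⟩ ⟨x, y, z, t, u, v, w, s, h, hg, hf⟩
      exact ⟨_, _, _, _, _, _, _, _, det_mul_ne_zero h h',
        fun p => ((congrArg (g' : G F).1 (hg p)).trans (hg' _)).trans (linForm_linForm ..),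
        fun q => ((congrArg f'.1 (hf q)).trans (hf' _)).trans (semi_semi ..)⟩)
    (fun g f f' h h' => Subtype.ext (h.unique h'))
  obtain ⟨σ, hσ⟩ := exists_hom_of_rel
    (fun (f : GammaL F (Fin 2 → F)) (g : MulAction.stabilizer (G F) (v1 (1 : G F))) =>
      ∃ x y z t s, x * t - y * z ≠ 0 ∧ (∀ q, (f : Equiv.Perm (Fin 2 → F)) q = semi x y z t s q) ∧
        ∀ p, ((g : G F) : Equiv.Perm (Omega F)) p = linForm x y z t 0 0 0 s p)
    (fun f => by
      obtain ⟨x, y, z, t, s, h, hf⟩ := exists_semi_of_mem_GammaL f.2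
      obtain ⟨g, hg, hg'⟩ := exists_linForm h 0 0 0 s
      exact ⟨⟨⟨g, G1_le_G hg⟩, smul_v1_one_iff.2 hg⟩, x, y, z, t, s, h, hf, hg'⟩)
    (fun f' f g' g => by
      rintro ⟨x', y', z', t', s', h', hf', hg'⟩ ⟨x, y, z, t, s, h, hf, hg⟩
      refine ⟨_, _, _, _, _, det_mul_ne_zero h h',
        fun q => ((congrArg f'.1 (hf q)).trans (hf' _)).trans (semi_semi ..),
        fun p => (((congrArg (g' : G F).1 (hg p)).trans (hg' _)).trans
          (linForm_linForm ..)).trans ?_⟩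
      simp)
    (fun f g g' => by
      rintro ⟨x', y', z', t', s', h', hf', hg'⟩ ⟨x, y, z, t, s, h, hf, hg⟩
      obtain ⟨rfl, rfl, rfl, rfl, rfl⟩ := semi_unique h' fun q => (hf' q).symm.trans (hf q)
      exact Subtype.ext (Subtype.ext (Equiv.ext fun p => (hg' p).trans (hg p).symm)))
  refine ⟨π, σ, hπ, fun f => Subtype.ext ((hπ _).unique ?_)⟩
  obtain ⟨x, y, z, t, s, h, hf, hg⟩ := hσ f
  exact ⟨x, y, z, t, 0, 0, 0, s, h, hg, hf⟩

theorem nonempty_elementaryAbelian {V : Type*} [AddCommGroup V] [Module (ZMod 3) V] [Finite V]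
    {n : ℕ} (h : Nat.card V = 3 ^ n) : Nonempty (ElementaryAbelian 3 n ≃* Multiplicative V) := by
  have : Fact (Nat.Prime 3) := ⟨Nat.prime_three⟩
  have := Fintype.ofFinite V
  have hc := Module.card_eq_pow_finrank (K := ZMod 3) (V := V)
  rw [← Nat.card_eq_fintype_card, h, ZMod.card] at hc
  have hn : n = Module.finrank (ZMod 3) V := Nat.pow_right_injective (by norm_num : 2 ≤ 3) hc
  have e : (Fin n → ZMod 3) ≃ₗ[ZMod 3] V := LinearEquiv.ofFinrankEq _ _ (by simp [← hn])
  exact ⟨AddEquiv.toMultiplicative e.toAddEquiv⟩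

theorem stabilizer_v1_mulEquiv {r : ℕ} (hF : Nat.card F = 3 ^ r) :
    ∃ φ : GammaL F (Fin 2 → F) →* MulAut (ElementaryAbelian 3 (3 * r)),
      Nonempty (MulAction.stabilizer (G F) (v1 (1 : G F)) ≃*
        ElementaryAbelian 3 (3 * r) ⋊[φ] GammaL F (Fin 2 → F)) := by
  obtain ⟨π, σ, hπ, hσ⟩ := exists_linearPart_hom F
  let _ : Algebra (ZMod 3) F := ZMod.algebra F 3
  obtain ⟨e⟩ := nonempty_elementaryAbelian (V := F × F × F) (n := 3 * r)
    (by rw [Nat.card_prod, Nat.card_prod, hF]; ring)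
  obtain ⟨i, hi⟩ := exists_hom_of_rel
    (fun (n : Multiplicative (F × F × F)) (g : MulAction.stabilizer (G F) (v1 (1 : G F))) =>
      ∀ p, ((g : G F) : Equiv.Perm (Omega F)) p =
        (p.1 + n.toAdd.1, p.2.1 + n.toAdd.2.1, p.2.2 + n.toAdd.2.2))
    (fun n => ⟨⟨gAlpha n.toAdd.1 n.toAdd.2.1 n.toAdd.2.2, smul_v1_one_iff.2 (alpha_mem_G1 _ _ _)⟩,
      fun p => rfl⟩)
    (fun n n' g g' h h' p => by
      rw [Subgroup.coe_mul, Subgroup.coe_mul, Equiv.Perm.mul_apply, h', h]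
      simp [add_comm, add_left_comm])
    (fun n g g' h h' =>
      Subtype.ext (Subtype.ext (Equiv.ext fun p => (h p).trans (h' p).symm)))
  refine exists_semidirect (i.comp e.toMonoidHom) ?_ π σ hσ fun g => ⟨fun h => ?_, ?_⟩
  · rw [MonoidHom.coe_comp]
    refine Function.Injective.comp (fun n n' h => ?_) e.injective
    have h1 := hi n (0, 0, 0)
    rw [h, hi n' (0, 0, 0)] at h1
    simp only [zero_add, Prod.mk.injEq] at h1
    exact Multiplicative.toAdd.injective
      (Prod.ext h1.1.symm (Prod.ext h1.2.1.symm h1.2.2.symm))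
  · obtain ⟨x, y, z, t, u, v, w, s, hdet, hg, hf⟩ := hπ g
    rw [h] at hf
    obtain ⟨rfl, rfl, rfl, rfl, rfl⟩ := semi_unique (x' := 1) (y' := 0) (z' := 0) (t' := 1)
      (s' := RingEquiv.refl F) hdet fun q => (hf q).symm.trans (by
        ext i; fin_cases i <;> simp [semi])
    refine ⟨e.symm (Multiplicative.ofAdd (u, v, w)), Subtype.ext (Subtype.ext
        (Equiv.ext fun p => ?_))⟩
    simp [hi, hg, linForm]
  · rintro ⟨n, rfl⟩
    refine Subtype.ext ((hπ _).unique ⟨1, 0, 0, 1, (e n).toAdd.1, (e n).toAdd.2.1,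
      (e n).toAdd.2.2, RingEquiv.refl F, by simp, fun p => ?_, fun q => ?_⟩)
    · simp [hi, linForm]
    · ext i
      fin_cases i <;> simp [semi]

theorem localAction_v1_mulEquiv (g : G F) :
    Nonempty (localAction (G F) (Delta F) (g • v1 1) ≃* PGammaL F (Fin 2 → F)) := by
  obtain ⟨π, σ, hπ, hσ⟩ := exists_linearPart_hom F
  let c := (MulAction.stabilizerEquivStabilizer (G := G F) (a := v1 (1 : G F)) (b := g • v1 1)
    (g := g) rfl).symm
  refine nonempty_localAction_mulEquiv adj_smul
    ((QuotientGroup.mk' (scalars F (Fin 2 → F))).comp (π.comp c.toMonoidHom)) ?_ fun h => ?_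
  · have hπs : Function.Surjective π := fun f => ⟨σ f, hσ f⟩
    exact (QuotientGroup.mk'_surjective _).comp (hπs.comp c.surjective)
  · have hc : ((c h : MulAction.stabilizer (G F) (v1 1)) : G F) = g⁻¹ * h * g := by
      simp [c, MulAction.stabilizerEquivStabilizer_symm_apply]
    rw [mem_localKernel_smul adj_smul, ← hc, MonoidHom.comp_apply, MonoidHom.comp_apply,
      QuotientGroup.mk'_apply, QuotientGroup.eq_one_iff]
    change π (c h) ∈ _ ↔ _
    generalize c h = k
    constructor
    · rintro ⟨a, ha⟩
      obtain ⟨x, y, z, t, u, v, w, s, hdet, hg, hf⟩ := hπ k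
      obtain ⟨rfl, rfl, rfl, rfl, rfl⟩ := semi_unique (x' := (a : F)) (y' := 0) (z' := 0)
        (t' := (a : F)) (s' := RingEquiv.refl F) hdet fun q => (hf q).symm.trans ((ha q).trans (by
          ext i; fin_cases i <;> simp [semi, Units.smul_def]))
      exact mem_localKernel_v1.2 ⟨a, u, v, w, a.ne_zero, hg⟩
    · intro hk
      obtain ⟨x, u, v, w, hx, hg⟩ := mem_localKernel_v1.1 hk
      have hdet : x * x - 0 * 0 ≠ 0 := by simpa using hx
      obtain ⟨f, hf⟩ := exists_semi hdet (RingEquiv.refl F)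
      refine ⟨Units.mk0 x hx, fun q => ?_⟩
      rw [(hπ k).unique ⟨x, 0, 0, x, u, v, w, RingEquiv.refl F, hdet, hg, hf⟩, hf]
      ext i
      fin_cases i <;> simp [semi, Units.smul_def]

end StabOne

/-! ### Sylow subgroups of `SL₂` and `ASL₂` -/

section SylowGroups

variable {F : Type*} [Field F]

theorem isPGroup_of_pow_three {Γ : Type*} [Group Γ] (h : ∀ g : Γ, g ^ 3 = 1) : IsPGroup 3 Γ :=
  fun g => ⟨1, by rw [pow_one, h]⟩

/-- The map `q ↦ (q₀ + e q₁ + u, q₁ + v)` of `F²`. -/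
def affPerm (e u v : F) : Equiv.Perm (Fin 2 → F) where
  toFun q := ![q 0 + e * q 1 + u, q 1 + v]
  invFun q := ![q 0 - u - e * (q 1 - v), q 1 - v]
  left_inv q := by
    ext i
    fin_cases i <;> simp
  right_inv q := by
    ext i
    fin_cases i <;> simp

theorem affPerm_apply (e u v : F) (q : Fin 2 → F) :
    affPerm e u v q = ![q 0 + e * q 1 + u, q 1 + v] := rfl

theorem affPerm_mul (e u v e' u' v' : F) :
    affPerm e' u' v' * affPerm e u v = affPerm (e' + e) (u + e' * v + u') (v + v') := by
  ext q i
  fin_cases i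
  · simp [affPerm]
    ring
  · simp [affPerm]
    ring

theorem affPerm_zero : affPerm (0 : F) 0 0 = 1 := by
  ext q i
  fin_cases i <;> simp [affPerm]

theorem affPerm_inv (e u v : F) : (affPerm e u v)⁻¹ = affPerm (-e) (-u + e * v) (-v) := by
  rw [inv_eq_iff_mul_eq_one, affPerm_mul, ← affPerm_zero]
  congr 1 <;> ring

theorem affPerm_injective {e u v e' u' v' : F} (h : affPerm e u v = affPerm e' u' v') :
    e = e' ∧ u = u' ∧ v = v' := by
  have h0 := congrArg (fun f : Equiv.Perm (Fin 2 → F) => f 0) h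
  have h1 := congrArg (fun f : Equiv.Perm (Fin 2 → F) => f ![0, 1]) h
  simp only [affPerm_apply, Matrix.vecCons_inj, Pi.zero_apply, mul_zero, zero_add, and_true,
    Matrix.cons_val_zero, Matrix.cons_val_one, mul_one] at h0 h1
  exact ⟨by linear_combination h1.1 - h0.1, h0.1, h0.2⟩

theorem affPerm_mem_SL2 (e : F) : affPerm e 0 0 ∈ SL2 F := by
  refine ⟨⟨!![1, e; 0, 1], by simp⟩, fun q => ?_⟩
  ext i
  fin_cases i <;> simp [affPerm, dotProduct, Fin.sum_univ_two]

theorem affPerm_mem_ASL2 (e u v : F) : affPerm e u v ∈ ASL2 F := by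
  refine ⟨⟨!![1, e; 0, 1], by simp⟩, ![u, v], fun q => ?_⟩
  ext i
  fin_cases i <;> simp [affPerm, dotProduct, Fin.sum_univ_two]

theorem affPerm_eq_semi (e : F) (q : Fin 2 → F) :
    affPerm e 0 0 q = semi 1 e 0 1 (RingEquiv.refl F) q := by
  ext i
  fin_cases i <;> simp [affPerm, semi]

theorem SL2_le_GammaL : SL2 F ≤ GammaL F (Fin 2 → F) := by
  rintro f ⟨A, hA⟩
  refine ⟨fun v w => by rw [hA, hA, hA, Matrix.mulVec_add], RingEquiv.refl F, fun c v => ?_⟩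
  rw [hA, hA, Matrix.mulVec_smul]
  rfl

variable (F) in
/-- The group of upper unitriangular matrices. -/
def unip : Subgroup (SL2 F) where
  carrier := {f | ∃ e, (f : Equiv.Perm (Fin 2 → F)) = affPerm e 0 0}
  one_mem' := ⟨0, affPerm_zero.symm⟩
  mul_mem' := by
    rintro f f' ⟨e, h⟩ ⟨e', h'⟩
    exact ⟨e + e', by rw [Subgroup.coe_mul, h, h', affPerm_mul]; simp⟩
  inv_mem' := by
    rintro f ⟨e, h⟩
    exact ⟨-e, by rw [Subgroup.coe_inv, h, affPerm_inv]; simp⟩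

variable [Finite F]

/-- The group `ΓL₂(F, S)` does not depend on the choice of `S`, as Sylow subgroups are
conjugate. -/
theorem nonempty_GammaL2N_mulEquiv (S S' : Sylow 3 (SL2 F)) :
    Nonempty (GammaL2N F S ≃* GammaL2N F S') := by
  have : Fact (Nat.Prime 3) := ⟨Nat.prime_three⟩
  obtain ⟨g, rfl⟩ := MulAction.exists_smul_eq (SL2 F) S S'
  have hmap : ∀ k : Equiv.Perm (Fin 2 → F),
      k ∈ ((g • S : Sylow 3 (SL2 F)) : Subgroup (SL2 F)).map (SL2 F).subtype ↔
        (g : Equiv.Perm (Fin 2 → F))⁻¹ * k * g ∈ (S : Subgroup (SL2 F)).map (SL2 F).subtype := by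
    intro k
    rw [Sylow.coe_subgroup_smul]
    constructor
    · rintro ⟨a, ha, rfl⟩
      exact ⟨_, Subgroup.mem_pointwise_smul_iff_inv_smul_mem.1 ha, by
        simp [← map_inv, MulAut.smul_def]⟩
    · rintro ⟨a, ha, h⟩
      refine ⟨g * a * g⁻¹, ?_, ?_⟩
      · refine Subgroup.mem_pointwise_smul_iff_inv_smul_mem.2 ?_
        rw [← map_inv, MulAut.smul_def, MulAut.conj_apply]
        have hga : g⁻¹ * (g * a * g⁻¹) * g⁻¹⁻¹ = a := by group
        rw [hga]
        exact ha
      · simp only [map_mul, map_inv, h]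
        simp only [Subgroup.subtype_apply]
        group
  have hg : (g : Equiv.Perm (Fin 2 → F)) ∈ GammaL F (Fin 2 → F) := SL2_le_GammaL g.2
  have key : (GammaL2N F S).map (MulAut.conj (g : Equiv.Perm (Fin 2 → F))).toMonoidHom =
      GammaL2N F (g • S) := by
    ext f
    rw [mem_map_conj, GammaL2N, GammaL2N, Subgroup.mem_inf, Subgroup.mem_inf]
    refine and_congr ?_ ?_
    · constructor
      · intro h
        have := mul_mem (mul_mem hg h) (inv_mem hg)
        convert this using 1
        group
      · exact fun h => mul_mem (mul_mem (inv_mem hg) h) hg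
    · rw [Subgroup.mem_normalizer_iff, Subgroup.mem_normalizer_iff]
      simp only [hmap]
      constructor
      · intro h k
        rw [h]
        apply iff_of_eq
        congr 1
        group
      · intro h k
        have := h ((g : Equiv.Perm (Fin 2 → F)) * k * (g : Equiv.Perm (Fin 2 → F))⁻¹)
        convert this using 2 <;> group
  exact ⟨((MulAut.conj (g : Equiv.Perm (Fin 2 → F))).subgroupMap (GammaL2N F S)).trans
    (MulEquiv.subgroupCongr key)⟩

variable [CharP F 3]

variable (F) in
/-- The upper unitriangular matrices form a Sylow `3`-subgroup of `SL₂`: a `3`-group containing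
them fixes a nonzero vector, which must be a multiple of the first basis vector. -/
def sylowSL2 : Sylow 3 (SL2 F) :=
  { unip F with
    isPGroup' := isPGroup_of_pow_three (by
      rintro ⟨f, e, h⟩
      refine Subtype.ext (Subtype.ext ?_)
      change (f : Equiv.Perm (Fin 2 → F)) ^ 3 = 1
      rw [h, pow_succ, pow_two, affPerm_mul, affPerm_mul, ← affPerm_zero]
      congr 1
      · linear_combination e * three_eq_zero (F := F)
      · simp
      · simp)
    is_maximal' := by
      intro Q hQ hle
      refine le_antisymm (fun f hf => ?_) hle
      have : Fact (Nat.Prime 3) := ⟨Nat.prime_three⟩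
      have hcard : 3 ∣ Nat.card (Fin 2 → F) := by
        have := Fintype.ofFinite F
        rw [Nat.card_fun, Nat.card_eq_fintype_card, ← CharP.cast_eq_zero_iff F 3, Nat.cast_pow,
          FiniteField.cast_card_eq_zero]
        simp
      have hfix : ∀ b : Fin 2 → F, b ∈ MulAction.fixedPoints Q (Fin 2 → F) →
          ∀ k ∈ Q, (k : Equiv.Perm (Fin 2 → F)) b = b := fun b hb k hk => hb ⟨k, hk⟩
      obtain ⟨b, hb, hne⟩ := hQ.exists_fixed_point_of_prime_dvd_card_of_fixed_point (Fin 2 → F)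
        hcard (a := 0) (by
          rintro ⟨⟨k, A, hA⟩, hk⟩
          change k 0 = 0
          rw [hA, Matrix.mulVec_zero])
      have h1 := hfix b hb ⟨_, affPerm_mem_SL2 1⟩ (hle ⟨1, rfl⟩)
      have hb1 : b 1 = 0 := by
        have := congrFun h1 0
        simpa [affPerm_apply] using this
      have hb0 : b 0 ≠ 0 := by
        intro h0
        refine hne (funext fun i => ?_)
        fin_cases i
        · exact h0.symm
        · exact hb1.symm
      have h2 := hfix b hb f hf
      obtain ⟨A, hA⟩ := f.2
      rw [hA] at h2
      have e0 := congrFun h2 0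
      have e1 := congrFun h2 1
      simp only [Matrix.mulVec, dotProduct, Fin.sum_univ_two, hb1, mul_zero, add_zero] at e0 e1
      have a00 : A.1 0 0 = 1 := mul_right_cancel₀ hb0 (by rw [e0, one_mul])
      have a10 : A.1 1 0 = 0 := by
        rcases mul_eq_zero.1 e1 with h | h
        · exact h
        · exact absurd h hb0
      have hdet := A.2
      rw [Matrix.det_fin_two, a00, a10, one_mul, mul_zero, sub_zero] at hdet
      refine ⟨A.1 0 1, Equiv.ext fun q => ?_⟩
      rw [hA]
      ext i
      fin_cases i
      · simp [affPerm, Matrix.mulVec, dotProduct, Fin.sum_univ_two, a00]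
      · simp [affPerm, Matrix.mulVec, dotProduct, Fin.sum_univ_two, a10, hdet] }

theorem mem_sylowSL2 {f : SL2 F} :
    f ∈ sylowSL2 F ↔ ∃ e, (f : Equiv.Perm (Fin 2 → F)) = affPerm e 0 0 := Iff.rfl

variable (F) in
/-- The Sylow `3`-subgroup of `ASL₂` is the preimage of that of `SL₂`, as the kernel of the
projection to `SL₂` is the `3`-group of translations. -/
theorem exists_sylowASL2 : ∃ U : Sylow 3 (ASL2 F), ∀ f : ASL2 F,
    f ∈ U ↔ ∃ e u v, (f : Equiv.Perm (Fin 2 → F)) = affPerm e u v := by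
  obtain ⟨π, hπ⟩ := exists_hom_of_rel
    (fun (f : ASL2 F) (k : SL2 F) => ∀ q, (f : Equiv.Perm (Fin 2 → F)) q =
      (k : Equiv.Perm (Fin 2 → F)) q + (f : Equiv.Perm (Fin 2 → F)) 0)
    (fun f => by
      obtain ⟨A, b, hA⟩ := f.2
      refine ⟨⟨(f : Equiv.Perm (Fin 2 → F)).trans (Equiv.subRight b), A, fun v => ?_⟩, fun q => ?_⟩
      · simp [hA]
      · simp [hA])
    (fun f f' k k' h h' q => by
      obtain ⟨A, hA⟩ := k.2
      simp only [Subgroup.coe_mul, Equiv.Perm.mul_apply]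
      rw [h' q, h, hA, Matrix.mulVec_add, ← hA, ← hA, h ((f' : Equiv.Perm (Fin 2 → F)) 0),
        add_assoc])
    (fun f k k' h h' => Subtype.ext (Equiv.ext fun q =>
      add_right_cancel ((h q).symm.trans (h' q))))
  have hsurj : π.range = ⊤ := by
    refine MonoidHom.range_eq_top.2 fun k => ?_
    obtain ⟨A, hA⟩ := k.2
    refine ⟨⟨k, A, 0, fun v => by rw [hA, add_zero]⟩, Subtype.ext (Equiv.ext fun q => ?_)⟩
    have := hπ ⟨k, A, 0, fun v => by rw [hA, add_zero]⟩ q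
    simp only [hA 0, Matrix.mulVec_zero, add_zero] at this
    exact this.symm
  have hker : IsPGroup 3 π.ker := isPGroup_of_pow_three (by
    rintro ⟨f, hf⟩
    rw [MonoidHom.mem_ker] at hf
    have h := hπ f
    rw [hf] at h
    simp only [Subgroup.coe_one, Equiv.Perm.one_apply] at h
    refine Subtype.ext (Subtype.ext (Equiv.ext fun q => ?_))
    change ((f : Equiv.Perm (Fin 2 → F)) ^ 3) q = q
    generalize (f : Equiv.Perm (Fin 2 → F)) = k at h
    have h3 : ∀ c : Fin 2 → F, c + c + c = 0 := fun c => funext fun i => by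
      simp only [Pi.add_apply, Pi.zero_apply]
      linear_combination c i * three_eq_zero (F := F)
    rw [pow_succ, pow_two, Equiv.Perm.mul_apply, Equiv.Perm.mul_apply, h (k (k q)), h (k q), h q,
      add_assoc, add_assoc, ← add_assoc (k 0), h3, add_zero])
  refine ⟨(sylowSL2 F).comapOfKerIsPGroup π hker (by rw [hsurj]; exact le_top), fun f => ?_⟩
  change π f ∈ sylowSL2 F ↔ _
  rw [mem_sylowSL2]
  constructor
  · rintro ⟨e, he⟩
    refine ⟨e, (f : Equiv.Perm (Fin 2 → F)) 0 0, (f : Equiv.Perm (Fin 2 → F)) 0 1,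
      Equiv.ext fun q => ?_⟩
    rw [hπ, he]
    ext i
    fin_cases i <;> simp [affPerm]
  · rintro ⟨e, u, v, h⟩
    refine ⟨e, Equiv.ext fun q => ?_⟩
    have := hπ f q
    rw [h] at this
    refine add_right_cancel (this.symm.trans ?_)
    ext i
    fin_cases i <;> simp [affPerm]

/-- The normalizer in `ΓL₂` of the upper unitriangular group is the group of upper triangular
semilinear maps. -/
theorem exists_semi_of_mem_GammaL2N {f : Equiv.Perm (Fin 2 → F)}
    (hf : f ∈ GammaL2N F (sylowSL2 F)) :
    ∃ x y t s, x ≠ 0 ∧ t ≠ 0 ∧ ∀ q, f q = semi x y 0 t s q := by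
  obtain ⟨h1, h2⟩ := hf
  obtain ⟨x, y, z, t, s, hdet, hf⟩ := exists_semi_of_mem_GammaL h1
  have hmem : affPerm (1 : F) 0 0 ∈
      (sylowSL2 F : Subgroup (SL2 F)).map (SL2 F).subtype :=
    ⟨⟨_, affPerm_mem_SL2 1⟩, mem_sylowSL2.2 ⟨1, rfl⟩, rfl⟩
  obtain ⟨k, hk, hk'⟩ := (Subgroup.mem_normalizer_iff.1 h2 _).1 hmem
  obtain ⟨e, he⟩ := mem_sylowSL2.1 hk
  have key : ∀ q, affPerm e 0 0 (f q) = f (affPerm 1 0 0 q) := fun q => by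
    rw [← he]
    change (SL2 F).subtype k (f q) = _
    rw [hk']
    simp
  have hz : z = 0 := by
    have := key ![0, 1]
    have h0 := key ![1, 0]
    simp only [hf, semi, affPerm_apply, Matrix.cons_val_zero, Matrix.cons_val_one, map_zero,
      map_one, mul_zero, mul_one, add_zero, zero_add, Matrix.vecCons_inj, and_true] at this h0
    linear_combination -this.2
  subst hz
  exact ⟨x, y, t, s, fun h => hdet (by simp [h]), fun h => hdet (by simp [h]), hf⟩

theorem mem_GammaL2N_of_semi {f : Equiv.Perm (Fin 2 → F)} {x y t : F} {s : F ≃+* F} (hx : x ≠ 0)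
    (ht : t ≠ 0) (hf : ∀ q, f q = semi x y 0 t s q) : f ∈ GammaL2N F (sylowSL2 F) := by
  have hmap : ∀ k : Equiv.Perm (Fin 2 → F),
      k ∈ (sylowSL2 F : Subgroup (SL2 F)).map (SL2 F).subtype ↔ ∃ e, k = affPerm e 0 0 := by
    intro k
    constructor
    · rintro ⟨k, hk, rfl⟩
      exact mem_sylowSL2.1 hk
    · rintro ⟨e, rfl⟩
      exact ⟨⟨_, affPerm_mem_SL2 e⟩, mem_sylowSL2.2 ⟨e, rfl⟩, rfl⟩
  have hcomm : ∀ e, f * affPerm e 0 0 = affPerm (x * s e / t) 0 0 * f := by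
    intro e
    ext1 q
    simp only [Equiv.Perm.mul_apply, affPerm_eq_semi, hf, semi_semi]
    congr 1 <;> field_simp <;> simp
    ring
  refine ⟨mem_GammaL_of_semi hf, Subgroup.mem_normalizer_iff.2 fun k => ?_⟩
  simp only [hmap]
  constructor
  · rintro ⟨e, rfl⟩
    exact ⟨_, mul_inv_eq_iff_eq_mul.2 (hcomm e)⟩
  · rintro ⟨e, he⟩
    refine ⟨s.symm (e * t / x), ?_⟩
    have h1 := hcomm (s.symm (e * t / x))
    rw [RingEquiv.apply_symm_apply, mul_div_cancel₀ _ hx, mul_div_cancel_right₀ _ ht,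
      ← mul_inv_eq_iff_eq_mul.1 he] at h1
    exact (mul_left_cancel h1).symm

end SylowGroups

/-! ### The stabilizer of a coset of `G₂` -/

section StabTwo

variable {F : Type*} [Field F] [Finite F] [CharP F 3]

theorem quadForm_unique {l m d e u v w l' m' d' e' u' v' w' : F} {s s' : F ≃+* F} (hl : l ≠ 0)
    (h : ∀ p, quadForm l m d e u v w s p = quadForm l' m' d' e' u' v' w' s' p) :
    l = l' ∧ m = m' ∧ d = d' ∧ e = e' ∧ u = u' ∧ v = v' ∧ w = w' ∧ s = s' := by
  have h0 := h (0, 0, 0)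
  have h1 := h (1, 0, 0)
  have h2 := h (0, 1, 0)
  have h3 := h (0, -1, 0)
  simp only [quadForm, map_zero, map_one, map_neg, Prod.mk.injEq] at h0 h1 h2 h3
  have hu : u = u' := by linear_combination h0.1
  have hv : v = v' := by linear_combination h0.2.1
  have hw : w = w' := by linear_combination h0.2.2
  have hll : l = l' := by linear_combination h1.1 - h0.1
  have hmm : m = m' := by linear_combination h2.2.1 - h0.2.1
  -- The even part in the second coordinate is `2 d`, and `2 = -1`.
  have hd : d = d' := by
    linear_combination (d - d') * three_eq_zero (F := F) - h2.1 - h3.1 + 2 * h0.1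
  have he : e = e' := by linear_combination h2.1 - h0.1 - hd
  subst hu hv hw hll hmm hd he
  refine ⟨rfl, rfl, rfl, rfl, rfl, rfl, rfl, RingEquiv.ext fun a => ?_⟩
  have ha := h (a, 0, 0)
  simp only [quadForm, map_zero, Prod.mk.injEq] at ha
  exact mul_left_cancel₀ hl (by linear_combination ha.1)

theorem quadForm_congr {l m d e u v w l' m' d' : F} {s : F ≃+* F} (p : Omega F) (hl : l = l')
    (hm : m = m') (hd : d = d') :
    quadForm l m d e u v w s p = quadForm l' m' d' e u v w s p := by
  rw [hl, hm, hd]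

theorem exists_upper_semi {x t : F} (hx : x ≠ 0) (ht : t ≠ 0) (y : F) (s : F ≃+* F) :
    ∃ f : GammaL2N F (sylowSL2 F), ∀ q, (f : Equiv.Perm (Fin 2 → F)) q = semi x y 0 t s q := by
  obtain ⟨f, hf⟩ := exists_semi (x := x) (y := y) (z := 0) (t := t) (by simp [hx, ht]) s
  exact ⟨⟨f, mem_GammaL2N_of_semi hx ht hf⟩, hf⟩

/-- An element of `G₂` and its image in the group of upper triangular semilinear maps: with
`l = x m`, the assignment `(l, m, d) ↦ (x, d / m; 0, m)` is multiplicative. -/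
def UpperPart (g : G F) (f : Equiv.Perm (Fin 2 → F)) : Prop :=
  ∃ x y m e u v w s, x ≠ 0 ∧ m ≠ 0 ∧
    (∀ p, (g : Equiv.Perm (Omega F)) p = quadForm (x * m) m (y * m) e u v w s p) ∧
    ∀ q, f q = semi x y 0 m s q

theorem UpperPart.unique {g : G F} {f f' : Equiv.Perm (Fin 2 → F)} (h : UpperPart g f)
    (h' : UpperPart g f') : f = f' := by
  obtain ⟨x, y, m, e, u, v, w, s, hx, hm, hg, hf⟩ := h
  obtain ⟨x', y', m', e', u', v', w', s', hx', hm', hg', hf'⟩ := h'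
  obtain ⟨hl, rfl, hd, -, -, -, -, rfl⟩ :=
    quadForm_unique (mul_ne_zero hx hm) fun p => (hg p).symm.trans (hg' p)
  obtain rfl := mul_right_cancel₀ hm hl
  obtain rfl := mul_right_cancel₀ hm hd
  exact Equiv.ext fun q => (hf q).trans (hf' q).symm

variable (F) in
/-- The projection of the stabilizer of `G₂` onto `ΓL₂(F, S)`, with its section `E S T Σ`. -/
theorem exists_upperPart_hom :
    ∃ (π : MulAction.stabilizer (G F) (v2 (1 : G F)) →* GammaL2N F (sylowSL2 F))
      (σ : GammaL2N F (sylowSL2 F) →* MulAction.stabilizer (G F) (v2 (1 : G F))),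
      (∀ g : MulAction.stabilizer (G F) (v2 (1 : G F)), UpperPart (g : G F) (π g)) ∧
        ∀ f, π (σ f) = f := by
  obtain ⟨π, hπ⟩ := exists_hom_of_rel
    (fun (g : MulAction.stabilizer (G F) (v2 (1 : G F))) (f : GammaL2N F (sylowSL2 F)) =>
      UpperPart (g : G F) (f : Equiv.Perm (Fin 2 → F)))
    (fun g => by
      obtain ⟨l, m, d, e, u, v, w, s, hl, hm, hg⟩ := mem_G2_iff.1 (smul_v2_one_iff.1 g.2)
      obtain ⟨f, hf⟩ := exists_upper_semi (div_ne_zero hl hm) hm (d / m) s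
      refine ⟨f, l / m, d / m, m, e, u, v, w, s, div_ne_zero hl hm, hm, fun p => ?_, hf⟩
      rw [div_mul_cancel₀ _ hm, div_mul_cancel₀ _ hm, hg])
    (fun g' g f' f => by
      rintro ⟨x', y', m', e', u', v', w', s', hx', hm', hg', hf'⟩
        ⟨x, y, m, e, u, v, w, s, hx, hm, hg, hf⟩
      refine ⟨x' * s' x, x' * s' y + y' * s' m, m' * s' m, _, _, _, _, _,
        mul_ne_zero hx' ((map_ne_zero s').2 hx), mul_ne_zero hm' ((map_ne_zero s').2 hm),
        fun p => (((congrArg (g' : G F).1 (hg p)).trans (hg' _)).trans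
          (quadForm_quadForm ..)).trans (quadForm_congr p ?_ rfl ?_),
        fun q => (((congrArg f'.1 (hf q)).trans (hf' _)).trans
          (semi_semi ..)).trans (semi_congr q ?_ ?_ ?_ ?_)⟩ <;> simp <;> ring)
    (fun g f f' h h' => Subtype.ext (h.unique h'))
  obtain ⟨σ, hσ⟩ := exists_hom_of_rel
    (fun (f : GammaL2N F (sylowSL2 F)) (g : MulAction.stabilizer (G F) (v2 (1 : G F))) =>
      ∃ x y m s, x ≠ 0 ∧ m ≠ 0 ∧ (∀ q, (f : Equiv.Perm (Fin 2 → F)) q = semi x y 0 m s q) ∧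
        ∀ p, ((g : G F) : Equiv.Perm (Omega F)) p = quadForm (x * m) m (y * m) 0 0 0 0 s p)
    (fun f => by
      obtain ⟨x, y, m, s, hx, hm, hf⟩ := exists_semi_of_mem_GammaL2N f.2
      obtain ⟨g, hg, hg'⟩ := exists_quadForm (mul_ne_zero hx hm) hm (y * m) 0 0 0 0 s
      exact ⟨⟨⟨g, G2_le_G hg⟩, smul_v2_one_iff.2 hg⟩, x, y, m, s, hx, hm, hf, hg'⟩)
    (fun f' f g' g => by
      rintro ⟨x', y', m', s', hx', hm', hf', hg'⟩ ⟨x, y, m, s, hx, hm, hf, hg⟩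
      refine ⟨x' * s' x, x' * s' y + y' * s' m, m' * s' m, s.trans s',
        mul_ne_zero hx' ((map_ne_zero s').2 hx), mul_ne_zero hm' ((map_ne_zero s').2 hm),
        fun q => (((congrArg f'.1 (hf q)).trans (hf' _)).trans
          (semi_semi ..)).trans (semi_congr q ?_ ?_ ?_ ?_),
        fun p => (((congrArg (g' : G F).1 (hg p)).trans (hg' _)).trans
          (quadForm_quadForm ..)).trans
            ((quadForm_congr (l' := x' * s' x * (m' * s' m)) (m' := m' * s' m)
              (d' := (x' * s' y + y' * s' m) * (m' * s' m)) p ?_ rfl ?_).trans ?_)⟩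
      rotate_left 6
      · simp
      all_goals simp
      all_goals ring)
    (fun f g g' => by
      rintro ⟨x', y', m', s', hx', hm', hf', hg'⟩ ⟨x, y, m, s, hx, hm, hf, hg⟩
      obtain ⟨rfl, rfl, -, rfl, rfl⟩ := semi_unique (by simp [hx', hm'])
        fun q => (hf' q).symm.trans (hf q)
      exact Subtype.ext (Subtype.ext (Equiv.ext fun p => (hg' p).trans (hg p).symm)))
  refine ⟨π, σ, hπ, fun f => Subtype.ext ((hπ _).unique ?_)⟩
  obtain ⟨x, y, m, s, hx, hm, hf, hg⟩ := hσ f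
  exact ⟨x, y, m, 0, 0, 0, 0, s, hx, hm, hg, hf⟩

/-- The kernel of the projection is `Q`, the direct product of the translations in the third
coordinate and a Sylow `3`-subgroup of `ASL₂` acting on the first two. -/
theorem stabilizer_v2_mulEquiv {r : ℕ} (hF : Nat.card F = 3 ^ r) (U : Sylow 3 (ASL2 F))
    (S : Sylow 3 (SL2 F)) :
    ∃ φ : GammaL2N F S →* MulAut (ElementaryAbelian 3 r × U),
      Nonempty (MulAction.stabilizer (G F) (v2 (1 : G F)) ≃*
        (ElementaryAbelian 3 r × U) ⋊[φ] GammaL2N F S) := by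
  have : Fact (Nat.Prime 3) := ⟨Nat.prime_three⟩
  obtain ⟨π, σ, hπ, hσ⟩ := exists_upperPart_hom F
  let _ : Algebra (ZMod 3) F := ZMod.algebra F 3
  obtain ⟨e⟩ := nonempty_elementaryAbelian (V := F) (n := r) hF
  obtain ⟨k⟩ := nonempty_GammaL2N_mulEquiv (sylowSL2 F) S
  obtain ⟨U₀, hU₀⟩ := exists_sylowASL2 F
  let c : ElementaryAbelian 3 r × U ≃* Multiplicative F × U₀ := e.prodCongr (U.equiv U₀)
  obtain ⟨i, hi⟩ := exists_hom_of_rel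
    (fun (n : Multiplicative F × U₀) (g : MulAction.stabilizer (G F) (v2 (1 : G F))) =>
      ∃ a u v, ((n.2 : ASL2 F) : Equiv.Perm (Fin 2 → F)) = affPerm a u v ∧
        ∀ p, ((g : G F) : Equiv.Perm (Omega F)) p =
          (p.1 + a * p.2.1 + u, p.2.1 + v, p.2.2 + n.1.toAdd))
    (fun n => by
      obtain ⟨a, u, v, h⟩ := (hU₀ _).1 n.2.2
      refine ⟨⟨gAlpha u v n.1.toAdd * gGamma a, smul_v2_one_iff.2
        (mul_mem (alpha_mem_G2 _ _ _) (gamma_mem_G2 _))⟩, a, u, v, h, fun p => rfl⟩)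
    (fun n n' g g' => by
      rintro ⟨a, u, v, h, hg⟩ ⟨a', u', v', h', hg'⟩
      refine ⟨a + a', u' + a * v' + u, v' + v, ?_, fun p => ?_⟩
      · rw [Prod.snd_mul, Subgroup.coe_mul, Subgroup.coe_mul, h, h', affPerm_mul]
      · rw [Subgroup.coe_mul, Subgroup.coe_mul, Equiv.Perm.mul_apply, hg', hg]
        simp only [Prod.fst_mul, toAdd_mul, Prod.mk.injEq]
        refine ⟨?_, ?_, ?_⟩ <;> ring)
    (fun n g g' => by
      rintro ⟨a, u, v, h, hg⟩ ⟨a', u', v', h', hg'⟩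
      obtain ⟨rfl, rfl, rfl⟩ := affPerm_injective (h.symm.trans h')
      exact Subtype.ext (Subtype.ext (Equiv.ext fun p => (hg p).trans (hg' p).symm)))
  refine exists_semidirect (i.comp c.toMonoidHom) ?_ (k.toMonoidHom.comp π)
    (σ.comp k.symm.toMonoidHom) (fun f => ?_) fun g => ?_
  · rw [MonoidHom.coe_comp]
    refine Function.Injective.comp (fun n n' h => ?_) c.injective
    obtain ⟨a, u, v, h1, hg⟩ := hi n
    obtain ⟨a', u', v', h1', hg'⟩ := hi n'
    rw [h] at hg
    have e0 := (hg (0, 0, 0)).symm.trans (hg' (0, 0, 0))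
    have e1 := (hg (0, 1, 0)).symm.trans (hg' (0, 1, 0))
    simp only [Prod.mk.injEq, mul_zero, zero_add, mul_one] at e0 e1
    obtain ⟨hu, hv, hw⟩ := e0
    subst hu hv
    have ha : a = a' := add_right_cancel e1.1
    subst ha
    exact Prod.ext (Multiplicative.toAdd.injective hw)
      (Subtype.ext (Subtype.ext (h1.trans h1'.symm)))
  · change k (π (σ (k.symm f))) = f
    rw [hσ, MulEquiv.apply_symm_apply]
  · change k (π g) = 1 ↔ ∃ n, i (c n) = g
    rw [map_eq_one_iff k k.injective]
    constructor
    · intro h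
      obtain ⟨x, y, m, a, u, v, w, s, hx, hm, hg, hf⟩ := hπ g
      rw [h] at hf
      obtain ⟨rfl, rfl, -, rfl, rfl⟩ := semi_unique (x' := 1) (y' := 0) (z' := 0) (t' := 1)
        (s' := RingEquiv.refl F) (by simp [hx, hm]) fun q => (hf q).symm.trans (by
          ext i; fin_cases i <;> simp [semi])
      let f : U₀ := ⟨⟨affPerm a u v, affPerm_mem_ASL2 a u v⟩, (hU₀ _).2 ⟨a, u, v, rfl⟩⟩
      refine ⟨c.symm (Multiplicative.ofAdd w, f), Subtype.ext (Subtype.ext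
        (Equiv.ext fun p => ?_))⟩
      rw [MulEquiv.apply_symm_apply]
      obtain ⟨a', u', v', h1, h2⟩ := hi (Multiplicative.ofAdd w, f)
      obtain ⟨rfl, rfl, rfl⟩ := affPerm_injective h1
      rw [h2, hg]
      simp [quadForm]
    · rintro ⟨n, rfl⟩
      obtain ⟨a, u, v, h1, h2⟩ := hi (c n)
      refine Subtype.ext ((hπ _).unique ⟨1, 0, 1, a, u, v, (c n).1.toAdd, RingEquiv.refl F, by simp,
        by simp, fun p => ?_, fun q => ?_⟩)
      · simp [h2, quadForm]
      · ext i
        fin_cases i <;> simp [semi]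

/-- The neighbours `τ_d G₁` of `G₂` form an affine line on which `G₂` induces `AΓL₁`. -/
theorem localAction_v2_mulEquiv (g : G F) :
    Nonempty (localAction (G F) (Delta F) (g • v2 1) ≃* AGammaL F F) := by
  obtain ⟨π, hπ⟩ := exists_hom_of_rel
    (fun (g : MulAction.stabilizer (G F) (v2 (1 : G F))) (f : AGammaL F F) =>
      ∀ d, (g : G F) • v1 (gTau d) = v1 (gTau ((f : Equiv.Perm F) d)))
    (fun g => by
      obtain ⟨l, m, d, e, u, v, w, s, hl, hm, hg⟩ := mem_G2_iff.1 (smul_v2_one_iff.1 g.2)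
      have hlm : l / m ^ 2 ≠ 0 := div_ne_zero hl (pow_ne_zero 2 hm)
      let h : Equiv.Perm F := s.toEquiv.trans (Equiv.mulLeft₀ _ hlm)
      have hh : ∀ x, h x = l / m ^ 2 * s x := fun x => rfl
      refine ⟨⟨h.trans (Equiv.addRight (d / m ^ 2)), h, ⟨fun x y => ?_, s, fun c x => ?_⟩,
        d / m ^ 2, fun x => rfl⟩, fun x => ?_⟩
      · rw [hh, hh, hh, map_add, mul_add]
      · rw [hh, hh, smul_eq_mul, smul_eq_mul, map_mul]
        ring
      · rw [smul_v1_tau_iff hl hm hg]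
        simp only [Equiv.trans_apply, Equiv.coe_addRight, hh]
        field_simp)
    (fun g g' f f' h h' d => by
      rw [Subgroup.coe_mul, mul_smul, h', h, Subgroup.coe_mul, Equiv.Perm.mul_apply])
    (fun g f f' h h' => Subtype.ext (Equiv.ext fun d =>
      v1_gTau_injective ((h d).symm.trans (h' d))))
  have hsurj : Function.Surjective π := by
    intro f
    obtain ⟨h, ⟨-, s, hs⟩, b, hf⟩ := f.2
    have hh : ∀ x, h x = s x * h 1 := fun x => by
      have := hs x 1
      rwa [smul_eq_mul, smul_eq_mul, mul_one] at this
    have h1 : h 1 ≠ 0 := by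
      intro h1
      have := (hh 1).trans ((by simp [h1]) : _ = s 0 * h 1)
      rw [← hh] at this
      exact one_ne_zero (h.injective this)
    obtain ⟨g, hg, hg'⟩ := exists_quadForm h1 (one_ne_zero (α := F)) b 0 0 0 0 s
    refine ⟨⟨⟨g, G2_le_G hg⟩, smul_v2_one_iff.2 hg⟩, Subtype.ext (Equiv.ext fun d => ?_)⟩
    refine v1_gTau_injective ((hπ ⟨⟨g, G2_le_G hg⟩, smul_v2_one_iff.2 hg⟩ d).symm.trans ?_)
    change (⟨g, G2_le_G hg⟩ : G F) • _ = _
    rw [smul_v1_tau_iff h1 one_ne_zero hg', hf, hh d]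
    ring
  let c := (MulAction.stabilizerEquivStabilizer (G := G F) (a := v2 (1 : G F)) (b := g • v2 1)
    (g := g) rfl).symm
  refine nonempty_localAction_mulEquiv adj_smul (π.comp c.toMonoidHom)
    (hsurj.comp c.surjective) fun h => ?_
  have hc : ((c h : MulAction.stabilizer (G F) (v2 (1 : G F))) : G F) = g⁻¹ * h * g := by
    simp [c, MulAction.stabilizerEquivStabilizer_symm_apply]
  rw [mem_localKernel_smul adj_smul, ← hc]
  change π (c h) = 1 ↔ _
  generalize c h = k
  rw [mem_localKernel]
  constructor
  · intro hk
    refine ⟨k.2, fun y hy => ?_⟩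
    obtain ⟨d, rfl⟩ := adj_v2_one_iff.1 hy
    rw [hπ, hk]
    rfl
  · rintro ⟨-, hk⟩
    refine Subtype.ext (Equiv.ext fun d => v1_gTau_injective ?_)
    change v1 (gTau _) = v1 (gTau d)
    rw [← hπ, hk _ (adj_v2_one_iff.2 ⟨d, rfl⟩)]

end StabTwo
end CosetGraph

open CosetGraph
theorem theorem1p1 (r : ℕ) (hr : 1 ≤ r) (F : Type*) [Field F] [Finite F] [CharP F 3]
    (hF : Nat.card F = 3 ^ r) :
    -- the standing meaning of "`G`-graph": finite, connected, `G ≤ Aut(Δ)`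
    IsGGraph (G F) (Delta F) ∧
    IsLocallyFinite (G F) (Vertex F) ∧
    LocallyArcTransitive (G F) (Delta F) 5 ∧
    -- `{x₁, x₂}` is any edge, `x₁` a coset of `G₁` and `x₂` a coset of `G₂`
    ∀ x₁ x₂ : Vertex F, x₁ ∈ Set.range Sum.inl → x₂ ∈ Set.range Sum.inr → (Delta F).Adj x₁ x₂ →
      PushingUpType (G F) (Delta F) 3 x₁ x₂ ∧
      -- (i)
      ((Delta F).neighborSet x₁).ncard = 3 ^ r + 1 ∧
      ((Delta F).neighborSet x₂).ncard = 3 ^ r ∧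
      -- (ii)
      Nonempty (localAction (G F) (Delta F) x₁ ≃*
        PGammaL F (Fin 2 → F)) ∧
      Nonempty (localAction (G F) (Delta F) x₂ ≃*
        AGammaL F F) ∧
      -- (iii)
      (∃ φ : GammaL F (Fin 2 → F) →*
          MulAut (ElementaryAbelian 3 (3 * r)),
        Nonempty (MulAction.stabilizer (G F) x₁ ≃*
          ElementaryAbelian 3 (3 * r) ⋊[φ] GammaL F (Fin 2 → F))) ∧
      -- (iv)
      (∀ (U : Sylow 3 (ASL2 F)) (S : Sylow 3 (SL2 F)),
        ∃ φ : GammaL2N F S →* MulAut (ElementaryAbelian 3 r × U),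
          Nonempty (MulAction.stabilizer (G F) x₂ ≃*
            (ElementaryAbelian 3 r × U) ⋊[φ] GammaL2N F S)) ∧
      -- (v)
      ArcTransitiveAt (G F) (Delta F) 6 x₂ := by
  refine ⟨isGGraph, isLocallyFinite, locallyArcTransitive_five, fun x₁ x₂ h₁ h₂ h => ?_⟩
  refine ⟨pushingUpType h₁ h, ?_⟩
  obtain ⟨g, rfl, rfl⟩ := exists_smul_of_adj h₁ h
  refine ⟨?_, ?_, localAction_v1_mulEquiv g, localAction_v2_mulEquiv g, ?_, fun U S => ?_,
    arcTransitiveAt_six h₂⟩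
  · rw [ncard_neighborSet_smul adj_smul, ncard_neighborSet_v1, hF]
  · rw [ncard_neighborSet_smul adj_smul, ncard_neighborSet_v2, hF]
  · obtain ⟨φ, ⟨e⟩⟩ := stabilizer_v1_mulEquiv hF
    exact ⟨φ, ⟨(MulAction.stabilizerEquivStabilizer rfl).symm.trans e⟩⟩
  · obtain ⟨φ, ⟨e⟩⟩ := stabilizer_v2_mulEquiv hF U S
    exact ⟨φ, ⟨(MulAction.stabilizerEquivStabilizer rfl).symm.trans e⟩⟩
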